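/- Setting. Let $(D,\mathcal M,\mu)$ be a finite standard Borel measure space, $H:=L^2(D,\mathcal M,\mu;\mathbb R)$ with nonnegative cone $H_+$, and $\mathcal A:\mathcal D(\mathcal A)\subseteq H\to H$ a densely defined, closed, self-adjoint operator with $\langle \mathcal A x,x\rangle\le-\delta|x|^2$ on $\mathcal D(\mathcal A)$ for some $\delta>0$, whose $C_0$-semigroup $(e^{t\mathcal A})_{t\ge0}$ is positivity-preserving. Let $W$ be a cylindrical Wiener process with values in a Hilbert space $K$ on a filtered probability space $(\Omega,\mathcal F,\mathbb F,\mathsf P)$ satisfying the usual conditions, and let $\sigma:K\to H$ be Hilbert–Schmidt. Let $\Delta\subseteq H_+$ be a convex cone with $0\in\Delta$, let $q\in H_+$ with $q\ge q_o\mathbf 1$ for some $q_o>0$, and let $\rho>0$. Let $\mathcal I$ be the set of $\mathbb F$-adapted càdlàg processes $I:\Omega\times[0,\infty)\to H_+$ (with $I_{0^-}:=0$) such that $I_t-I_{s^-}\in\Delta$ for all $0\le s\le t$, which have locally finite variation in $H$ and for which, writing $\mathrm dI=\hat\vartheta\,\mathrm d|I|$ with $|I|$ the variation measure of $I$ on $[0,\infty)$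 (including the jump $I_0$ at time $0$) and $\hat\vartheta$ an $H_+$-valued density, $$\mathsf E\Big[\Big(\int_{[0,T]}|\hat\vartheta_s|_H\,\mathrm d|I|_s\Big)^2\Big]+\mathsf E\Big[\int_{[0,T]}\frac{|\hat\vartheta_s|_H^2}{\langle q,\hat\vartheta_s\rangle}\,\mathrm d|I|_s\Big]<\infty\qquad\text{for all }T>0 .$$ For $x\in H$ and $I\in\mathcal I$ let $$X^{x,I}_t=e^{t\mathcal A}x+\int_0^te^{(t-s)\mathcal A}\sigma\,\mathrm dW_s+\int_{[0,t]}e^{(t-s)\mathcal A}\hat\vartheta_s\,\mathrm d|I|_s,\qquad t\ge0,$$ $$\mathcal J(x;I)=\mathsf E\Big[\int_{0}^\infty e^{-\rho t}G(X^{x,I}_t)\,\mathrm dt+\int_{[0,\infty)}e^{-\rho t}\langle q,\hat\vartheta_t\rangle\,\mathrm d|I|_t\Big]\in(-\infty,+\infty],\qquad V(x)=\inf_{I\in\mathcal I}\mathcal J(x;I),$$ where $G:H\to\mathbb R$ is convex and there are constants $c_o,\kappa_1,\kappa_2,c_1>0$ such that, for all $x,y\in H$ and $\lambda\in[0,1]$,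 $$\kappa_1|x|^2-\kappa_2\le G(x)\le c_o(1+|x|^2),\qquad \lambda G(x)+(1-\lambda)G(y)-G(\lambda x+(1-\lambda)y)\le\tfrac{c_1}{2}\lambda(1-\lambda)|x-y|^2 .$$ Proposition 3.1. The value function $V$ is real-valued on $H$, and: (i) $V$ is convex; (ii) there exists $\hat c_o>0$ such that $-\kappa_2/\rho\le V(x)\le\hat c_o(1+|x|_H^2)$ for all $x\in H$; (iii) $V$ is locally Lipschitz; (iv) $V$ is semiconcave with a quadratic modulus: there exists $\hat c_1>0$ such that $\lambda V(x)+(1-\lambda)V(y)-V(\lambda x+(1-\lambda)y)\le\frac{\hat c_1}{2}\lambda(1-\lambda)|x-y|_H^2$ for all $x,y\in H$ and $\lambda\in[0,1]$; (v) $V\in C^{1,\mathrm{Lip}}(H)$, i.e. $V$ is continuously Fréchet differentiable on $H$ with a Lipschitz continuous gradient. -/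

import Mathlib

open MeasureTheory ProbabilityTheory Filter Topology Set
open scoped NNReal ENNReal

namespace SingularControl

section Semigroup

variable {H : Type*} [NormedAddCommGroup H] [InnerProductSpace ℝ H]

/-- `S` is a strongly continuous (`C₀`) semigroup of bounded operators on `H`. -/
structure IsC0Semigroup (S : ℝ≥0 → H →L[ℝ] H) : Prop where
  map_zero : S 0 = ContinuousLinearMap.id ℝ H
  map_add : ∀ s t, S (s + t) = (S s).comp (S t)
  continuous_orbit : ∀ x, Continuous fun t => S t x

/-- The (unbounded) operator `A` is the infinitesimal generator of `S`: its domain is the set of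
all `x` for which `lim_{t → 0+} (S t x - x) / t` exists, and there `A x` is that limit. Thus a
`C₀` semigroup `S` with this property is `S t = e^{tA}`. -/
def IsGenerator (A : H →ₗ.[ℝ] H) (S : ℝ≥0 → H →L[ℝ] H) : Prop :=
  ∀ x y : H, (x, y) ∈ A.graph ↔
    Tendsto (fun t : ℝ≥0 => (t : ℝ)⁻¹ • (S t x - x)) (𝓝[>] 0) (𝓝 y)

/-- `⟨A x, x⟩ ≤ -δ ‖x‖²` on the domain of `A`. -/
def IsDissipativeWith (A : H →ₗ.[ℝ] H) (δ : ℝ) : Prop :=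
  ∀ x : A.domain, inner ℝ (A x) (x : H) ≤ -δ * ‖(x : H)‖ ^ 2

/-- `σ : K → H` is a Hilbert-Schmidt operator: `∑ ‖σ eᵢ‖² < ∞` for an orthonormal basis `(eᵢ)`
of `K` (equivalently, for all of them). -/
def IsHilbertSchmidt {K : Type*} [NormedAddCommGroup K] [InnerProductSpace ℝ K]
    (σ : K →L[ℝ] H) : Prop :=
  ∃ (ι : Set K) (b : HilbertBasis ι ℝ K), Summable fun i => ‖σ (b i)‖ ^ 2

end Semigroup

section Probability

variable {Ω : Type*} [mΩ : MeasurableSpace Ω]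

/-- The usual conditions: the filtration is right-continuous and `𝓕 0` contains every `P`-null
set (in particular the probability space is complete). -/
structure UsualConditions (P : Measure Ω) (𝓕 : Filtration ℝ≥0 mΩ) : Prop where
  right_continuous : 𝓕.IsRightContinuous
  complete : ∀ N : Set Ω, P N = 0 → MeasurableSet[𝓕 0] N

variable {K : Type*} [NormedAddCommGroup K] [InnerProductSpace ℝ K]

/-- `W` is a cylindrical Wiener process in `K` on the filtered probability space `(Ω, 𝓕, P)`;
`W t k` plays the role of `⟨W_t, k⟩`. -/
structure IsCylindricalWiener (P : Measure Ω) (𝓕 : Filtration ℝ≥0 mΩ)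
    (W : ℝ≥0 → K → Ω → ℝ) : Prop where
  adapted : ∀ t k, StronglyMeasurable[𝓕 t] (W t k)
  linear : ∀ t (a b : ℝ) (k l : K),
    W t (a • k + b • l) =ᵐ[P] fun ω => a * W t k ω + b * W t l ω
  zero : ∀ k, W 0 k =ᵐ[P] 0
  law_increment : ∀ s t k, s ≤ t →
    HasLaw (fun ω => W t k ω - W s k ω) (gaussianReal 0 ((t - s) * ‖k‖₊ ^ 2)) P
  indep_increment : ∀ s t k, s ≤ t →
    Indep (MeasurableSpace.comap (fun ω => W t k ω - W s k ω) inferInstance) (𝓕 s) P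
  continuous_paths : ∀ k, ∀ᵐ ω ∂P, Continuous fun t => W t k ω

/-- The Riemann-Itô sum of a deterministic `f : [0, t] → K` against `W` over the partition of
`[0, t]` into `n` intervals of equal length. -/
noncomputable def wienerSum (W : ℝ≥0 → K → Ω → ℝ) (f : ℝ≥0 → K) (t : ℝ≥0) (n : ℕ) (ω : Ω) : ℝ :=
  ∑ i ∈ Finset.range n,
    (W (t * ((i + 1 : ℕ) / n)) (f (t * (i / n))) ω - W (t * (i / n)) (f (t * (i / n))) ω)

/-- `Y = ∫₀ᵗ ⟨f s, dW_s⟩` for a deterministic continuous integrand `f : [0, t] → K`: `Y` is the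
`L²(P)`-limit of the Riemann-Itô sums. -/
def IsWienerIntegral (P : Measure Ω) (W : ℝ≥0 → K → Ω → ℝ) (f : ℝ≥0 → K) (t : ℝ≥0)
    (Y : Ω → ℝ) : Prop :=
  Tendsto (fun n : ℕ => eLpNorm (fun ω => wienerSum W f t n ω - Y ω) 2 P) atTop (𝓝 0)

/-- `Z` is a (jointly measurable version of the) stochastic convolution
`Z_t = ∫₀ᵗ S (t - s) σ dW_s`. As usual, the `H`-valued integral is determined by
`⟨Z_t, h⟩ = ∫₀ᵗ ⟨(S (t - s) σ)* h, dW_s⟩` a.s. for all `h`. The continuous version is an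
example of such a `Z`. -/
structure IsStochasticConvolution {H : Type*} [NormedAddCommGroup H] [InnerProductSpace ℝ H]
    [CompleteSpace H] [CompleteSpace K] (P : Measure Ω) (W : ℝ≥0 → K → Ω → ℝ)
    (S : ℝ≥0 → H →L[ℝ] H) (σ : K →L[ℝ] H) (Z : ℝ≥0 → Ω → H) : Prop where
  measurable : StronglyMeasurable (Function.uncurry Z)
  inner_eq : ∀ t h, IsWienerIntegral P W
    (fun s => ContinuousLinearMap.adjoint ((S (t - s)).comp σ) h) t (fun ω => inner ℝ (Z t ω) h)

end Probability

section Control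

variable {D : Type*} [MeasurableSpace D] {Ω : Type*} [mΩ : MeasurableSpace Ω]

/-- The Hilbert space `L²(D, μ; ℝ)`. Its order is the almost everywhere order. -/
abbrev StateSpace (μ : Measure D) := Lp ℝ 2 μ

/-- The operator `T` maps the nonnegative cone of `L²(D, μ)` into itself. -/
def IsPositivityPreserving {μ : Measure D} (T : StateSpace μ →L[ℝ] StateSpace μ) : Prop :=
  ∀ x, 0 ≤ x → 0 ≤ T x

/-- The left limit `γ_{s-}` of a path, with the convention `γ_{0-} = 0`. -/
noncomputable def valueBefore {H : Type*} [NormedAddCommGroup H] (γ : ℝ≥0 → H) (s : ℝ≥0) : H :=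
  if s = 0 then 0 else Function.leftLim γ s

/-- Right-continuous paths with left limits. -/
def IsCadlag {H : Type*} [TopologicalSpace H] (γ : ℝ≥0 → H) : Prop :=
  ∀ t, ContinuousWithinAt γ (Ici t) t ∧ ∃ l, Tendsto γ (𝓝[<] t) (𝓝 l)

/-- The set `𝓘` of admissible singular controls, with each control `I = toFun` recorded together
with its (uniquely determined, up to null sets) variation measure `|I| = var` and its polar density
`ϑ̂ = dir`, i.e. `dI = ϑ̂ d|I|`. -/
structure AdmissibleControl {μ : Measure D} (P : Measure Ω) (𝓕 : Filtration ℝ≥0 mΩ)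
    (Δ : PointedCone ℝ (StateSpace μ)) (q : StateSpace μ) where
  /-- the control process `I` -/
  toFun : ℝ≥0 → Ω → StateSpace μ
  /-- the random measure `|I|` on `[0, ∞)` -/
  var : Kernel Ω ℝ≥0
  /-- the density `ϑ̂` of `dI` with respect to `|I|` -/
  dir : ℝ≥0 → Ω → StateSpace μ
  adapted : ∀ t, StronglyMeasurable[𝓕 t] (toFun t)
  cadlag : ∀ᵐ ω ∂P, IsCadlag fun t => toFun t ω
  /-- `I_t - I_{s-} ∈ Δ`; for `s = 0` this says `I_t ∈ Δ` -/
  increment_mem : ∀ᵐ ω ∂P, ∀ s t, s ≤ t →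
    toFun t ω - valueBefore (fun r => toFun r ω) s ∈ Δ
  /-- `|I|([0, t])` is the total variation in `L²(D, μ)` of `I` on `[0, t]`, including the
  initial jump from `I_{0-} = 0` to `I_0` -/
  var_eq : ∀ᵐ ω ∂P, ∀ t,
    var ω (Icc 0 t) = ‖toFun 0 ω‖ₑ + eVariationOn (fun r => toFun r ω) (Icc 0 t)
  dir_measurable : StronglyMeasurable (Function.uncurry dir)
  dir_nonneg : ∀ᵐ ω ∂P, ∀ t, 0 ≤ dir t ω
  dir_integrable : ∀ᵐ ω ∂P, ∀ t, IntegrableOn (fun s => dir s ω) (Icc 0 t) (var ω)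
  eq_integral : ∀ᵐ ω ∂P, ∀ t, toFun t ω = ∫ s in Icc 0 t, dir s ω ∂(var ω)
  /-- `E[(∫_{[0,T]} |ϑ̂| d|I|)²] < ∞` -/
  moment_sq : ∀ T, ∫⁻ ω, (∫⁻ s in Icc 0 T, ‖dir s ω‖ₑ ∂(var ω)) ^ 2 ∂P < ∞
  /-- `E[∫_{[0,T]} |ϑ̂|² / ⟨q, ϑ̂⟩ d|I|] < ∞` -/
  moment_ratio : ∀ T, ∫⁻ ω, ∫⁻ s in Icc 0 T,
    ENNReal.ofReal (‖dir s ω‖ ^ 2 / inner ℝ q (dir s ω)) ∂(var ω) ∂P < ∞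

variable {μ : Measure D} {P : Measure Ω} {𝓕 : Filtration ℝ≥0 mΩ}
  {Δ : PointedCone ℝ (StateSpace μ)} {q : StateSpace μ}

/-- The mild solution
`X_t = e^{tA} x + ∫₀ᵗ e^{(t-s)A} σ dW_s + ∫_{[0,t]} e^{(t-s)A} dI_s` of
`dX = A X dt + σ dW + dI`, `X_{0-} = x`, where `S t = e^{tA}` and `Z` is the stochastic
convolution. -/
noncomputable def state (S : ℝ≥0 → StateSpace μ →L[ℝ] StateSpace μ)
    (Z : ℝ≥0 → Ω → StateSpace μ) (x : StateSpace μ) (I : AdmissibleControl P 𝓕 Δ q)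
    (t : ℝ≥0) (ω : Ω) : StateSpace μ :=
  S t x + Z t ω + ∫ s in Icc 0 t, S (t - s) (I.dir s ω) ∂(I.var ω)

/-- `E[∫₀^∞ e^{-ρt} g(X_t) dt]` for (the positive part of) a function `g`. -/
noncomputable def runningCost (ρ : ℝ) (S : ℝ≥0 → StateSpace μ →L[ℝ] StateSpace μ)
    (Z : ℝ≥0 → Ω → StateSpace μ) (x : StateSpace μ) (I : AdmissibleControl P 𝓕 Δ q)
    (g : StateSpace μ → ℝ) : ℝ≥0∞ :=
  ∫⁻ ω, ∫⁻ t in Ici (0 : ℝ),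
    ENNReal.ofReal (Real.exp (-ρ * t) * g (state S Z x I t.toNNReal ω)) ∂volume ∂P

/-- `E[∫_{0-}^∞ e^{-ρt} ⟨q, dI_t⟩]`, where `⟨q, dI_t⟩ = ⟨q, ϑ̂_t⟩ d|I|_t`. -/
noncomputable def controlCost (ρ : ℝ) (I : AdmissibleControl P 𝓕 Δ q) : ℝ≥0∞ :=
  ∫⁻ ω, ∫⁻ t, ENNReal.ofReal (Real.exp (-ρ * t) * inner ℝ q (I.dir t ω)) ∂(I.var ω) ∂P

/-- The cost `J(x; I) = E[∫_{0-}^∞ e^{-ρt} (G(X_t) dt + ⟨q, dI_t⟩)]` as an extended real number: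
the expectation of the nonnegative terms minus the expectation of the term with the negative
part `G⁻`, which is finite when `G` is bounded below. -/
noncomputable def cost (ρ : ℝ) (S : ℝ≥0 → StateSpace μ →L[ℝ] StateSpace μ)
    (Z : ℝ≥0 → Ω → StateSpace μ) (G : StateSpace μ → ℝ) (x : StateSpace μ)
    (I : AdmissibleControl P 𝓕 Δ q) : EReal :=
  ((runningCost ρ S Z x I (fun y => max (G y) 0) + controlCost ρ I : ℝ≥0∞) : EReal)
    - ((runningCost ρ S Z x I (fun y => max (-G y) 0) : ℝ≥0∞) : EReal)

/-- The value function `V(x) = inf_{I ∈ 𝓘} J(x; I)`. -/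
noncomputable def valueFunction (P : Measure Ω) (𝓕 : Filtration ℝ≥0 mΩ)
    (Δ : PointedCone ℝ (StateSpace μ)) (q : StateSpace μ) (ρ : ℝ)
    (S : ℝ≥0 → StateSpace μ →L[ℝ] StateSpace μ) (Z : ℝ≥0 → Ω → StateSpace μ)
    (G : StateSpace μ → ℝ) (x : StateSpace μ) : EReal :=
  ⨅ I : AdmissibleControl P 𝓕 Δ q, cost ρ S Z G x I

end Control

/-- `F` is semiconcave (with a quadratic modulus) with constant `c`. -/
def IsSemiconcave {H : Type*} [NormedAddCommGroup H] [NormedSpace ℝ H] (F : H → ℝ) (c : ℝ) :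
    Prop :=
  ∀ x y : H, ∀ l ∈ Icc (0 : ℝ) 1,
    l * F x + (1 - l) * F y - F (l • x + (1 - l) • y) ≤ c / 2 * l * (1 - l) * ‖x - y‖ ^ 2

/-- `F ∈ C^{1,Lip}(H)`: `F` is continuously Fréchet differentiable on `H` with a (globally)
Lipschitz gradient. -/
def IsC1Lip {H : Type*} [NormedAddCommGroup H] [InnerProductSpace ℝ H] [CompleteSpace H]
    (F : H → ℝ) : Prop :=
  ContDiff ℝ 1 F ∧ ∃ L : ℝ≥0, LipschitzWith L (gradient F)

end SingularControl

/-!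
The value function inherits convexity, semiconcavity and growth from the cost functional, because
the state is affine in the pair (initial condition, control).

* Replacing `G` by `G + κ₂ ≥ 0` changes every cost by the constant `κ₂ / ρ`
  (`cost_eq_shiftedCost_sub`), so that all expectations become integrals of nonnegative functions
  over `P ⊗ e^{-ρt} dt` (`runningCost_eq_lintegral_prod`) and `V` is, up to that constant, an
  infimum in `[0, ∞]`.
* Convexity: if `I` and `J` are controls for `x` and `y`, then `a I + b J` is a control for
  `a x + b y` whose cost is at most the average of the costs (`exists_shiftedCost_combination_le`).
  The main point is that `a I + b J` is admissible, i.e. that it has a measurable variation measure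
  and polar density: both controls have densities with respect to one finite kernel
  (`exists_common_density`, by the Radon-Nikodym theorem for kernels), the combined density is
  polarized, and `variation_cumulative_eq` identifies the variation measure of `η dν` as
  `‖η‖ dν`. The condition on `‖ϑ̂‖² / ⟨q, ϑ̂⟩` is inherited since `v ↦ ‖v‖² / ⟨q, v⟩` is sublinear
  on the nonnegative cone (`sq_norm_div_inner_add_le`).
* Semiconcavity: with one control `I` for `x`, `y` and `a x + b y`, the states started from `x` and
  `y` differ by `S t (x - y)`, and `‖S t‖ ≤ 1` by dissipativity, so the semiconcavity of `G`
  integrates to that of the cost with constant `c₁ / ρ` (`shiftedCost_semiconcave`).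
* Growth: the control `0` has cost `≤ C (1 + ‖x‖²)` since `E ‖Z_t‖² ≤ 2 t ‖σ‖²_HS`, by the Itô
  isometry for Riemann sums (`IsStochasticConvolution.lintegral_sq_le`).
* Regularity: a convex function bounded above by a quadratic is continuous, hence has subgradients.
  With semiconcavity these are Fréchet derivatives and depend on the point in a Lipschitz way
  (`isC1Lip_of_convexOn_of_isSemiconcave`).
-/

namespace SingularControl

/-! ### Convex and semiconcave functions -/

section ConvexAnalysis

/-- A convex function on a normed space that is locally bounded above is continuous. -/
theorem continuous_of_convexOn_of_le_quadratic {E : Type*} [NormedAddCommGroup E] [NormedSpace ℝ E]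
    {F : E → ℝ} (hF : ConvexOn ℝ univ F) {C : ℝ} (hC : 0 ≤ C)
    (hle : ∀ x, F x ≤ C * (1 + ‖x‖ ^ 2)) : Continuous F := by
  rw [← continuousOn_univ]
  have htfae := (hF.continuousOn_tfae isOpen_univ univ_nonempty).out 3 1
  refine htfae.mp ⟨0, mem_univ _, C * 2, ?_⟩
  simp only [eventually_map]
  filter_upwards [Metric.ball_mem_nhds (0 : E) one_pos] with x hx
  have hx1 : ‖x‖ ≤ 1 := (mem_ball_zero_iff.mp hx).le
  refine (hle x).trans (mul_le_mul_of_nonneg_left ?_ hC)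
  nlinarith [norm_nonneg x]

/-- A subgradient comes from separating `(x, F x)` from the open strict epigraph; continuity of
`F` is what makes the epigraph open. -/
theorem exists_subgradient {E : Type*} [NormedAddCommGroup E] [NormedSpace ℝ E]
    {F : E → ℝ} (hF : ConvexOn ℝ univ F) (hc : Continuous F) (x : E) :
    ∃ p : E →L[ℝ] ℝ, ∀ y, F x + p (y - x) ≤ F y := by
  have hopen : IsOpen {z : E × ℝ | z.1 ∈ univ ∧ F z.1 < z.2} := by
    simpa using isOpen_lt (hc.comp continuous_fst) continuous_snd
  obtain ⟨f, hf⟩ := geometric_hahn_banach_point_open hF.convex_strict_epigraph hopen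
    (x := (x, F x)) (by simp)
  set c : ℝ := f (0, 1)
  have hfe : ∀ y r, f (y, r) = f (y, 0) + r * c := by
    intro y r
    have : ((y, r) : E × ℝ) = (y, 0) + r • (0, 1) := by simp
    rw [this, map_add, map_smul, smul_eq_mul]
  have hcpos : 0 < c := by
    have := hf (x, F x + 1) (by simp)
    rw [hfe, hfe x (F x + 1)] at this
    linarith
  refine ⟨-(c⁻¹ • (f.comp (ContinuousLinearMap.inl ℝ E ℝ))), fun y => ?_⟩
  have key : f (x, 0) + F x * c ≤ f (y, 0) + F y * c := by
    refine le_of_forall_pos_le_add fun ε hε => ?_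
    have := hf (y, F y + ε / c) (by simp; positivity)
    rw [hfe, hfe y (F y + ε / c), add_mul, div_mul_cancel₀ _ hcpos.ne'] at this
    linarith
  have hsub : f (y - x, 0) = f (y, 0) - f (x, 0) := by
    rw [← map_sub]; simp
  simp only [neg_apply, smul_apply, smul_eq_mul,
    ContinuousLinearMap.comp_apply, ContinuousLinearMap.inl_apply]
  rw [hsub]
  have : c⁻¹ * (f (y, 0) - f (x, 0)) = (f (y, 0) - f (x, 0)) / c := by
    rw [div_eq_inv_mul]
  rw [this, ← sub_nonneg]
  have h2 : F y - (F x + -((f (y, 0) - f (x, 0)) / c))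
      = ((f (y, 0) + F y * c) - (f (x, 0) + F x * c)) / c := by
    field_simp; ring
  rw [h2]
  exact div_nonneg (by linarith) hcpos.le

variable {E : Type*} [NormedAddCommGroup E] [InnerProductSpace ℝ E]

/-- A semiconcave function with a subgradient at `x` lies below a paraboloid touching it at `x`.
The constant is twice the optimal one. -/
theorem IsSemiconcave.le_subgradient_add {F : E → ℝ} {c : ℝ} (hs : IsSemiconcave F c) {x : E}
    {p : E →L[ℝ] ℝ} (hp : ∀ y, F x + p (y - x) ≤ F y) (y : E) :
    F y ≤ F x + p (y - x) + c * ‖y - x‖ ^ 2 := by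
  have h1 := hs y (x - (y - x)) (1 / 2) (by norm_num)
  have h2 := hp (x - (y - x))
  have e1 : (1 / 2 : ℝ) • y + (1 - 1 / 2 : ℝ) • (x - (y - x)) = x := by module
  have e2 : y - (x - (y - x)) = (2 : ℝ) • (y - x) := by module
  have e3 : x - (y - x) - x = -(y - x) := by abel
  rw [e1, e2, norm_smul] at h1
  rw [e3, map_neg] at h2
  norm_num at h1
  nlinarith

/-- A continuous function on a Hilbert space that is convex and semiconcave is `C^{1,Lip}`. -/
theorem isC1Lip_of_convexOn_of_isSemiconcave [CompleteSpace E] {F : E → ℝ}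
    (hF : ConvexOn ℝ univ F) (hc : Continuous F) {c : ℝ} (hc0 : 0 ≤ c) (hs : IsSemiconcave F c) :
    IsC1Lip F := by
  choose p hp using exists_subgradient hF hc
  have hup := fun x => hs.le_subgradient_add (hp x)
  have hderiv : ∀ x, HasFDerivAt F (p x) x := by
    intro x
    rw [hasFDerivAt_iff_isLittleO]
    refine Asymptotics.IsBigO.trans_isLittleO (g := fun y => ‖y - x‖ ^ 2) ?_ ?_
    · refine Asymptotics.IsBigO.of_bound c (Eventually.of_forall fun y => ?_)
      have h1 := hp x y
      have h2 := hup x y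
      rw [Real.norm_of_nonneg (by linarith), Real.norm_of_nonneg (by positivity)]
      linarith
    · have : (fun y => ‖y - x‖ ^ 2) =o[𝓝 x] fun y => ‖y - x‖ ^ 1 := by
        refine (Asymptotics.isLittleO_pow_pow (𝕜 := ℝ) (m := 1) (n := 2) (by norm_num)).comp_tendsto
          (k := fun y : E => ‖y - x‖) ?_
        have : Continuous fun y : E => ‖y - x‖ := by fun_prop
        simpa using this.tendsto x
      exact (this.congr_right fun y => pow_one _).of_norm_right
  -- Comparing the affine minorant at `x` with the quadratic majorant at `y` in the point `y + h`
  -- bounds `(p x - p y) h` by `c (‖y - x‖² + ‖h‖²)`; the choice `‖h‖ = ‖y - x‖` is optimal.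
  have hlip : ∀ x y, ‖p x - p y‖ ≤ 2 * c * ‖x - y‖ := by
    intro x y
    rcases eq_or_ne x y with rfl | hxy
    · simp
    have hr : 0 < ‖x - y‖ := norm_pos_iff.mpr (sub_ne_zero.mpr hxy)
    have hmain : ∀ h : E, (p x - p y) h ≤ c * ‖x - y‖ ^ 2 + c * ‖h‖ ^ 2 := by
      intro h
      have h1 := hp x (y + h)
      have h2 := hup y (y + h)
      have h3 := hup x y
      have h4 := hp x y
      have h6 : F y ≤ F x + p x (y - x) + c * ‖x - y‖ ^ 2 := by
        rw [norm_sub_rev x y]; exact h3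
      have e1 : y + h - x = (y - x) + h := by abel
      rw [e1, map_add] at h1
      rw [add_sub_cancel_left] at h2
      simp only [sub_apply]
      linarith
    refine ContinuousLinearMap.opNorm_le_bound _ (by positivity) fun h => ?_
    rcases eq_or_ne h 0 with rfl | hh
    · simp
    have hhn : 0 < ‖h‖ := norm_pos_iff.mpr hh
    have aux : ∀ k : E, ‖k‖ = ‖h‖ → (p x - p y) k ≤ 2 * c * ‖x - y‖ * ‖h‖ := by
      intro k hk
      have := hmain ((‖x - y‖ / ‖h‖) • k)
      rw [map_smul, norm_smul, hk, Real.norm_of_nonneg (by positivity),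
        div_mul_cancel₀ _ hhn.ne', smul_eq_mul, div_mul_eq_mul_div, div_le_iff₀ hhn] at this
      nlinarith
    rw [Real.norm_eq_abs, abs_le]
    constructor
    · have := aux (-h) (norm_neg h)
      rw [map_neg] at this
      linarith
    · exact aux h rfl
  have hpl : LipschitzWith (2 * c).toNNReal p := by
    refine LipschitzWith.of_dist_le_mul fun x y => ?_
    rw [dist_eq_norm, dist_eq_norm, Real.coe_toNNReal _ (by positivity)]
    exact hlip x y
  have hfd : fderiv ℝ F = p := funext fun x => (hderiv x).fderiv
  refine ⟨?_, (2 * c).toNNReal, ?_⟩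
  · rw [contDiff_one_iff_fderiv, hfd]
    exact ⟨fun x => (hderiv x).differentiableAt, hpl.continuous⟩
  · have : gradient F = (InnerProductSpace.toDual ℝ E).symm ∘ p := by
      funext x; simp [gradient, hfd]
    rw [this]
    simpa using (InnerProductSpace.toDual ℝ E).symm.lipschitz.comp hpl

end ConvexAnalysis

/-! ### Dissipative generators and contraction semigroups -/

section Contraction

variable {H : Type*} [NormedAddCommGroup H] [InnerProductSpace ℝ H]

/-- The domain of the generator is invariant under the semigroup, and `A S_t = S_t A` on it. -/
theorem IsGenerator.apply_mem_graph {A : H →ₗ.[ℝ] H} {S : ℝ≥0 → H →L[ℝ] H}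
    (hAS : IsGenerator A S) (hS : IsC0Semigroup S) {x y : H} (hxy : (x, y) ∈ A.graph) (t : ℝ≥0) :
    (S t x, S t y) ∈ A.graph := by
  rw [hAS] at hxy ⊢
  refine (((S t).continuous.tendsto y).comp hxy).congr fun h => ?_
  simp only [Function.comp_apply, map_smul, map_sub]
  rw [← ContinuousLinearMap.comp_apply, ← hS.map_add, add_comm, hS.map_add,
    ContinuousLinearMap.comp_apply]

theorem IsGenerator.hasDerivWithinAt_orbit {A : H →ₗ.[ℝ] H} {S : ℝ≥0 → H →L[ℝ] H}
    (hAS : IsGenerator A S) (hS : IsC0Semigroup S) {x y : H} (hxy : (x, y) ∈ A.graph) {t : ℝ}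
    (ht : 0 ≤ t) :
    HasDerivWithinAt (fun s : ℝ => S s.toNNReal x) (S t.toNNReal y) (Ici t) t := by
  have h0 := hAS.apply_mem_graph hS hxy t.toNNReal
  rw [hAS] at h0
  rw [hasDerivWithinAt_iff_tendsto_slope]
  have hset : Ici t \ {t} = Ioi t := Ici_sdiff_left
  rw [hset]
  have hsub : Tendsto (fun s : ℝ => (s - t).toNNReal) (𝓝[>] t) (𝓝[>] 0) := by
    refine tendsto_nhdsWithin_iff.mpr ⟨?_, ?_⟩
    · have : Continuous fun s : ℝ => (s - t).toNNReal := by fun_prop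
      have h := this.tendsto t
      rw [sub_self, Real.toNNReal_zero] at h
      exact h.mono_left nhdsWithin_le_nhds
    · filter_upwards [self_mem_nhdsWithin] with s hs
      simpa using hs
  refine (h0.comp hsub).congr' ?_
  filter_upwards [self_mem_nhdsWithin] with s (hs : t < s)
  have e : s.toNNReal = (s - t).toNNReal + t.toNNReal := by
    rw [← Real.toNNReal_add (by linarith) ht]; congr 1; ring
  simp only [Function.comp_apply, slope_def_module]
  rw [e, hS.map_add, ContinuousLinearMap.comp_apply, Real.coe_toNNReal _ (by linarith)]

/-- The semigroup of a dissipative operator is contractive: on the domain, `‖S_t x‖²` has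
nonpositive right derivative `2 ⟨A S_t x, S_t x⟩`. -/
theorem IsDissipativeWith.norm_semigroup_apply_le {A : H →ₗ.[ℝ] H} {S : ℝ≥0 → H →L[ℝ] H}
    {δ : ℝ} (hA : IsDissipativeWith A δ) (hδ : 0 ≤ δ) (hdense : Dense (A.domain : Set H))
    (hAS : IsGenerator A S) (hS : IsC0Semigroup S) (t : ℝ≥0) (x : H) : ‖S t x‖ ≤ ‖x‖ := by
  refine hdense.induction (P := fun x => ‖S t x‖ ≤ ‖x‖) (fun x hx => ?_)
    (isClosed_le (by fun_prop) (by fun_prop)) x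
  have hxy : (x, A ⟨x, hx⟩) ∈ A.graph := A.mem_graph ⟨x, hx⟩
  set y := A ⟨x, hx⟩
  have hcont : Continuous fun s : ℝ => S s.toNNReal x :=
    (hS.continuous_orbit x).comp continuous_real_toNNReal
  have hderiv : ∀ s ∈ Ico (0 : ℝ) t, HasDerivWithinAt (fun s : ℝ => ‖S s.toNNReal x‖ ^ 2)
      (2 * inner ℝ (S s.toNNReal x) (S s.toNNReal y)) (Ici s) s := fun s hs =>
    (hAS.hasDerivWithinAt_orbit hS hxy hs.1).norm_sq
  have hneg : ∀ s ∈ Ico (0 : ℝ) t, 2 * inner ℝ (S s.toNNReal x) (S s.toNNReal y) ≤ (0 : ℝ) := by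
    intro s _
    obtain ⟨z, hz1, hz2⟩ := A.mem_graph_iff.mp (hAS.apply_mem_graph hS hxy s.toNNReal)
    have := hA z
    rw [hz2, hz1, real_inner_comm] at this
    nlinarith [mul_nonneg hδ (sq_nonneg ‖S s.toNNReal x‖)]
  have key : ‖S (t : ℝ).toNNReal x‖ ^ 2 ≤ ‖x‖ ^ 2 :=
    image_le_of_deriv_right_le_deriv_boundary (f := fun s : ℝ => ‖S s.toNNReal x‖ ^ 2)
      (B := fun _ => ‖x‖ ^ 2) (B' := fun _ => 0) (hcont.norm.pow 2).continuousOn hderiv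
      (by simp [hS.map_zero]) continuousOn_const (fun s _ => hasDerivWithinAt_const _ _ _) hneg
      (right_mem_Icc.mpr t.coe_nonneg)
  rw [Real.toNNReal_coe] at key
  exact pow_le_pow_iff_left₀ (norm_nonneg _) (norm_nonneg _) two_ne_zero |>.mp key

theorem IsC0Semigroup.continuous_uncurry {S : ℝ≥0 → H →L[ℝ] H} (hS : IsC0Semigroup S)
    (hcontr : ∀ t x, ‖S t x‖ ≤ ‖x‖) : Continuous fun z : ℝ≥0 × H => S z.1 z.2 := by
  refine continuous_iff_continuousAt.mpr fun ⟨t, x⟩ => ?_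
  rw [ContinuousAt, tendsto_iff_norm_sub_tendsto_zero]
  have h1 : Tendsto (fun z : ℝ≥0 × H => ‖z.2 - x‖ + ‖S z.1 x - S t x‖) (𝓝 (t, x)) (𝓝 0) := by
    have hc : Continuous fun z : ℝ≥0 × H => ‖z.2 - x‖ + ‖S z.1 x - S t x‖ := by
      have := (hS.continuous_orbit x).comp (continuous_fst (X := ℝ≥0) (Y := H))
      simp only [Function.comp_def] at this
      exact (continuous_snd.sub continuous_const).norm.add (this.sub continuous_const).norm
    simpa using hc.tendsto (t, x)
  refine squeeze_zero (fun _ => norm_nonneg _) (fun z => ?_) h1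
  calc ‖S z.1 z.2 - S t x‖ = ‖S z.1 (z.2 - x) + (S z.1 x - S t x)‖ := by
        rw [map_sub]; congr 1; abel
    _ ≤ ‖S z.1 (z.2 - x)‖ + ‖S z.1 x - S t x‖ := norm_add_le _ _
    _ ≤ _ := by gcongr; exact hcontr _ _

end Contraction

/-! ### The variation of a cumulative integral -/

section Variation

variable {H : Type*} [NormedAddCommGroup H] [NormedSpace ℝ H]

theorem sum_setLIntegral_Ioc {ν : Measure ℝ≥0} (f : ℝ≥0 → ℝ≥0∞) {u : ℕ → ℝ≥0} (hu : Monotone u)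
    (n : ℕ) : ∑ i ∈ Finset.range n, ∫⁻ s in Ioc (u i) (u (i + 1)), f s ∂ν
      = ∫⁻ s in Ioc (u 0) (u n), f s ∂ν := by
  induction n with
  | zero => simp
  | succ n ih =>
    rw [Finset.sum_range_succ, ih, ← lintegral_union measurableSet_Ioc
      (Ioc_disjoint_Ioc_of_le le_rfl),
      Ioc_union_Ioc_eq_Ioc (hu (Nat.zero_le n)) (hu n.le_succ)]

theorem Icc_zero_eq_union_Ioc {u v : ℝ≥0} (huv : u ≤ v) : Icc 0 v = Icc 0 u ∪ Ioc u v :=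
  (Icc_union_Ioc_eq_Icc zero_le huv).symm

theorem disjoint_Icc_zero_Ioc (u v : ℝ≥0) : Disjoint (Icc 0 u) (Ioc u v) :=
  disjoint_left.mpr fun _ hs hs' => (hs.2.trans_lt hs'.1).false

theorem cumulative_sub_cumulative {ν : Measure ℝ≥0} {η : ℝ≥0 → H}
    (hη : ∀ t, IntegrableOn η (Icc 0 t) ν) {u v : ℝ≥0} (huv : u ≤ v) :
    (∫ s in Icc 0 v, η s ∂ν) - ∫ s in Icc 0 u, η s ∂ν = ∫ s in Ioc u v, η s ∂ν := by
  have hint : IntegrableOn η (Ioc u v) ν :=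
    (hη v).mono_set (Ioc_subset_Icc_self.trans (Icc_subset_Icc_left zero_le))
  rw [Icc_zero_eq_union_Ioc huv, setIntegral_union (disjoint_Icc_zero_Ioc u v) measurableSet_Ioc
    (hη u) hint, add_sub_cancel_left]

theorem edist_cumulative {ν : Measure ℝ≥0} {η : ℝ≥0 → H}
    (hη : ∀ t, IntegrableOn η (Icc 0 t) ν) {u v : ℝ≥0} (huv : u ≤ v) :
    edist (∫ s in Icc 0 v, η s ∂ν) (∫ s in Icc 0 u, η s ∂ν) = ‖∫ s in Ioc u v, η s ∂ν‖ₑ := by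
  rw [edist_eq_enorm_sub, cumulative_sub_cumulative hη huv]

theorem setLIntegral_Icc_zero_eq_add (ν : Measure ℝ≥0) (f : ℝ≥0 → ℝ≥0∞) (t : ℝ≥0) :
    ∫⁻ s in Icc 0 t, f s ∂ν = ∫⁻ s in Icc 0 0, f s ∂ν + ∫⁻ s in Ioc 0 t, f s ∂ν := by
  rw [Icc_zero_eq_union_Ioc (zero_le (a := t)), lintegral_union measurableSet_Ioc
    (disjoint_Icc_zero_Ioc 0 t)]

/-- The total variation of `t ↦ ∫_{[0,t]} η dν`, with its jump at `0`, is at most `∫ ‖η‖ dν`; no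
finiteness of `ν` is needed. -/
theorem variation_cumulative_le {ν : Measure ℝ≥0} {η : ℝ≥0 → H}
    (hη : ∀ t, IntegrableOn η (Icc 0 t) ν) (t : ℝ≥0) :
    ‖∫ s in Icc 0 0, η s ∂ν‖ₑ + eVariationOn (fun r => ∫ s in Icc 0 r, η s ∂ν) (Icc 0 t)
      ≤ ∫⁻ s in Icc 0 t, ‖η s‖ₑ ∂ν := by
  rw [setLIntegral_Icc_zero_eq_add]
  refine add_le_add (enorm_integral_le_lintegral_enorm _) (iSup_le ?_)
  rintro ⟨n, u, hu, hut⟩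
  calc ∑ i ∈ Finset.range n, edist (∫ s in Icc 0 (u (i + 1)), η s ∂ν) (∫ s in Icc 0 (u i), η s ∂ν)
      ≤ ∑ i ∈ Finset.range n, ∫⁻ s in Ioc (u i) (u (i + 1)), ‖η s‖ₑ ∂ν := by
        refine Finset.sum_le_sum fun i _ => ?_
        rw [edist_cumulative hη (hu i.le_succ)]
        exact enorm_integral_le_lintegral_enorm _
    _ = ∫⁻ s in Ioc (u 0) (u n), ‖η s‖ₑ ∂ν := sum_setLIntegral_Ioc _ hu n
    _ ≤ ∫⁻ s in Ioc 0 t, ‖η s‖ₑ ∂ν :=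
        lintegral_mono_set (Ioc_subset_Ioc zero_le (hut n).2)

/-- On a cell `C` where `η` is `L¹`-close to a constant `c`, the norm of the integral almost equals
the integral of the norm. -/
theorem setLIntegral_enorm_le_add_two_mul [CompleteSpace H] {ν : Measure ℝ≥0} [IsFiniteMeasure ν]
    {η : ℝ≥0 → H} {C : Set ℝ≥0} (hη : IntegrableOn η C ν) (c : H) :
    ∫⁻ s in C, ‖η s‖ₑ ∂ν ≤ ‖∫ s in C, η s ∂ν‖ₑ + 2 * ∫⁻ s in C, ‖η s - c‖ₑ ∂ν := by
  have hc : IntegrableOn (fun _ => c) C ν := integrable_const c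
  have h1 : ∫⁻ s in C, ‖η s‖ₑ ∂ν ≤ (∫⁻ s in C, ‖η s - c‖ₑ ∂ν) + ‖c‖ₑ * ν C := by
    calc ∫⁻ s in C, ‖η s‖ₑ ∂ν ≤ ∫⁻ s in C, (‖η s - c‖ₑ + ‖c‖ₑ) ∂ν := by
          refine lintegral_mono fun s => ?_
          simpa using enorm_add_le (η s - c) c
      _ = _ := by
          rw [lintegral_add_right _ measurable_const]
          simp
  have h2 : ‖c‖ₑ * ν C ≤ ‖∫ s in C, η s ∂ν‖ₑ + ∫⁻ s in C, ‖η s - c‖ₑ ∂ν := by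
    have e : ‖c‖ₑ * ν C = ‖∫ _ in C, c ∂ν‖ₑ := by
      rw [integral_const, enorm_smul, mul_comm, measureReal_restrict_apply_univ, measureReal_def,
        Real.enorm_of_nonneg ENNReal.toReal_nonneg, ENNReal.ofReal_toReal (measure_ne_top _ _)]
    have e2 : ∫ _ in C, c ∂ν = (∫ s in C, η s ∂ν) - ∫ s in C, (η s - c) ∂ν := by
      rw [integral_sub hη hc]; abel
    rw [e, e2]
    exact (enorm_sub_le).trans (add_le_add le_rfl (enorm_integral_le_lintegral_enorm _))
  calc _ ≤ _ := h1
    _ ≤ (∫⁻ s in C, ‖η s - c‖ₑ ∂ν) + (‖∫ s in C, η s ∂ν‖ₑ + ∫⁻ s in C, ‖η s - c‖ₑ ∂ν) := by gcongr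
    _ = _ := by ring

/-- For a finite measure `ν`, the variation measure of `η dν` is `‖η‖ dν`: the total variation of
`t ↦ ∫_{[0,t]} η dν`, with its jump at `0`, is `∫ ‖η‖ dν`. -/
theorem variation_cumulative_eq [CompleteSpace H] {ν : Measure ℝ≥0} [IsFiniteMeasure ν]
    {η : ℝ≥0 → H} (hη : ∀ t, IntegrableOn η (Icc 0 t) ν) (t : ℝ≥0) :
    ‖∫ s in Icc 0 0, η s ∂ν‖ₑ + eVariationOn (fun r => ∫ s in Icc 0 r, η s ∂ν) (Icc 0 t)
      = ∫⁻ s in Icc 0 t, ‖η s‖ₑ ∂ν := by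
  refine le_antisymm (variation_cumulative_le hη t) ?_
  rw [setLIntegral_Icc_zero_eq_add]
  refine add_le_add ?_ ?_
  · refine (setLIntegral_enorm_le_add_two_mul (hη 0) (η 0)).trans (le_of_eq ?_)
    simp
  -- On the cells of a fine partition `η` is `L¹`-close to the constant `g (t (i + 1) / n)`, where
  -- `g` is a continuous approximation of `η`; for a constant density there is no loss.
  refine ENNReal.le_of_forall_pos_le_add fun ε hε _ => ?_
  set m : ℝ≥0 := (ν univ).toNNReal with hm
  have hmν : ν univ = m := (ENNReal.coe_toNNReal (measure_ne_top _ _)).symm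
  set e : ℝ≥0 := ε / (2 * (1 + m)) with he
  have hepos : 0 < e := by positivity
  obtain ⟨g, hg, -⟩ := Integrable.exists_boundedContinuous_lintegral_sub_le (hη t)
    (ε := e) (by exact_mod_cast hepos.ne')
  obtain ⟨d, hd, hgd⟩ := Metric.uniformContinuousOn_iff_le.mp
    (isCompact_Icc.uniformContinuousOn_of_continuous (s := Icc (0 : ℝ≥0) t)
      g.continuous.continuousOn)
    e hepos
  obtain ⟨n, hn⟩ := exists_nat_gt (t / d : ℝ)
  have hn0 : (0 : ℝ) < n := lt_of_le_of_lt (by positivity) hn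
  let u : ℕ → ℝ≥0 := fun i => t * (min i n / n)
  have hu : Monotone u := by
    intro i j hij
    simp only [u]
    gcongr
  have hun : u n = t := by
    simp only [u, min_self]
    rw [div_self (by exact_mod_cast hn0.ne'), mul_one]
  have hu0 : u 0 = 0 := by simp [u]
  have hut : ∀ i, u i ∈ Icc 0 t := fun i => ⟨zero_le, by
    refine mul_le_of_le_one_right zero_le (div_le_one_of_le₀ ?_ zero_le)
    exact_mod_cast min_le_right i n⟩
  have hstep : ∀ i, ∀ s ∈ Ioc (u i) (u (i + 1)), dist s (u (i + 1)) ≤ d := by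
    intro i s hs
    have h1 : ((u (i + 1) : ℝ≥0) : ℝ) ≤ u i + t / n := by
      have : u (i + 1) ≤ u i + t / n := by
        simp only [u]
        rw [← mul_one_div t (n : ℝ≥0), ← mul_add, ← add_div]
        gcongr
        rw [min_def, min_def]
        split_ifs <;> norm_cast <;> omega
      exact_mod_cast this
    have h2 : (t / n : ℝ) ≤ d := by
      rw [div_le_iff₀ hn0]
      rw [div_lt_iff₀ hd] at hn
      linarith
    have h3 : (u i : ℝ) < s := by exact_mod_cast hs.1
    have h4 : (s : ℝ) ≤ u (i + 1) := by exact_mod_cast hs.2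
    rw [NNReal.dist_eq, abs_le]
    constructor <;> linarith
  have hsub : ∀ i, Ioc (u i) (u (i + 1)) ⊆ Icc 0 t := fun i s hs =>
    ⟨zero_le, hs.2.trans (hut _).2⟩
  calc ∫⁻ s in Ioc 0 t, ‖η s‖ₑ ∂ν
      = ∑ i ∈ Finset.range n, ∫⁻ s in Ioc (u i) (u (i + 1)), ‖η s‖ₑ ∂ν := by
        rw [sum_setLIntegral_Ioc _ hu, hun, hu0]
    _ ≤ ∑ i ∈ Finset.range n, (edist (∫ s in Icc 0 (u (i + 1)), η s ∂ν) (∫ s in Icc 0 (u i), η s ∂ν)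
          + 2 * ∫⁻ s in Ioc (u i) (u (i + 1)), (‖η s - g s‖ₑ + e) ∂ν) := by
        refine Finset.sum_le_sum fun i _ => ?_
        rw [edist_cumulative hη (hu i.le_succ)]
        refine (setLIntegral_enorm_le_add_two_mul ((hη t).mono_set (hsub i))
          (g (u (i + 1)))).trans ?_
        gcongr 2
        refine setLIntegral_mono' measurableSet_Ioc fun s hs => ?_
        have h1 : ‖g s - g (u (i + 1))‖ₑ ≤ e := by
          rw [← edist_eq_enorm_sub, edist_dist, ENNReal.ofReal_le_iff_le_toReal (by simp)]
          exact hgd s (hsub i hs) _ (hut _) (hstep i s hs)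
        calc ‖η s - g (u (i + 1))‖ₑ = ‖(η s - g s) + (g s - g (u (i + 1)))‖ₑ := by
              congr 1; abel
          _ ≤ _ := (enorm_add_le _ _).trans (by gcongr)
    _ = (∑ i ∈ Finset.range n,
            edist (∫ s in Icc 0 (u (i + 1)), η s ∂ν) (∫ s in Icc 0 (u i), η s ∂ν))
          + 2 * ∫⁻ s in Ioc 0 t, (‖η s - g s‖ₑ + e) ∂ν := by
        rw [Finset.sum_add_distrib, ← Finset.mul_sum, sum_setLIntegral_Ioc _ hu, hun, hu0]
    _ ≤ eVariationOn (fun r => ∫ s in Icc 0 r, η s ∂ν) (Icc 0 t) + ε := by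
        refine _root_.add_le_add (eVariationOn.sum_le hu hut) ?_
        calc 2 * ∫⁻ s in Ioc 0 t, (‖η s - g s‖ₑ + e) ∂ν
            ≤ 2 * ∫⁻ s in Icc 0 t, (‖η s - g s‖ₑ + e) ∂ν := by
              gcongr; exact Ioc_subset_Icc_self
          _ = 2 * ((∫⁻ s in Icc 0 t, ‖η s - g s‖ₑ ∂ν) + e * ν (Icc 0 t)) := by
              rw [lintegral_add_right _ measurable_const]; simp
          _ ≤ 2 * (e + e * m) := by
              gcongr
              rw [← hmν]; exact measure_mono (subset_univ _)
          _ = ε := by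
              have : 2 * (e + e * m) = ε := by
                rw [he]; field_simp
              exact_mod_cast this

end Variation

/-! ### Common densities of random measures -/

section Kernel

variable {Ω : Type*} [mΩ : MeasurableSpace Ω]

/-- The factor `2⁻ⁿ / (1 + κ_ω [n, n + 1))` by which `κ_ω` is scaled down on `[n, n + 1)` to obtain
a finite kernel. It vanishes if `κ_ω [n, n + 1) = ∞`. -/
noncomputable def cellWeight (κ : Kernel Ω ℝ≥0) (n : ℕ) (ω : Ω) : ℝ≥0∞ :=
  ((2 : ℝ≥0∞) ^ n)⁻¹ * (1 + κ ω (Ico n (n + 1)))⁻¹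

theorem measurable_cellWeight (κ : Kernel Ω ℝ≥0) (n : ℕ) : Measurable (cellWeight κ n) :=
  ((measurable_const.add (κ.measurable_coe measurableSet_Ico)).inv).const_mul _

/-- The finite kernel obtained from `κ` by scaling it down on each interval `[n, n + 1)`. -/
noncomputable def normalizedKernel (κ : Kernel Ω ℝ≥0) : Kernel Ω ℝ≥0 where
  toFun ω := Measure.sum fun n : ℕ => cellWeight κ n ω • (κ ω).restrict (Ico n (n + 1))
  measurable' := by
    refine Measure.measurable_of_measurable_coe _ fun B hB => ?_
    simp only [Measure.sum_apply _ hB, Measure.smul_apply, Measure.restrict_apply hB, smul_eq_mul]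
    exact Measurable.tsum fun n =>
      (measurable_cellWeight κ n).mul (κ.measurable_coe (hB.inter measurableSet_Ico))

theorem normalizedKernel_apply (κ : Kernel Ω ℝ≥0) (ω : Ω) : normalizedKernel κ ω =
    Measure.sum fun n : ℕ => cellWeight κ n ω • (κ ω).restrict (Ico n (n + 1)) := rfl

instance isFiniteKernel_normalizedKernel (κ : Kernel Ω ℝ≥0) :
    IsFiniteKernel (normalizedKernel κ) := by
  refine ⟨⟨2, by simp, fun ω => ?_⟩⟩
  rw [normalizedKernel_apply, Measure.sum_apply _ MeasurableSet.univ]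
  calc ∑' n : ℕ, (cellWeight κ n ω • (κ ω).restrict (Ico (n : ℝ≥0) (n + 1))) univ
      ≤ ∑' n : ℕ, ((2 : ℝ≥0∞)⁻¹) ^ n := by
        refine ENNReal.tsum_le_tsum fun n => ?_
        simp only [Measure.smul_apply, Measure.restrict_apply_univ, smul_eq_mul, cellWeight]
        rw [← ENNReal.inv_pow, mul_assoc]
        refine mul_le_of_le_one_right zero_le ?_
        calc (1 + κ ω (Ico (n : ℝ≥0) (n + 1)))⁻¹ * κ ω (Ico (n : ℝ≥0) (n + 1))
            ≤ (1 + κ ω (Ico (n : ℝ≥0) (n + 1)))⁻¹ * (1 + κ ω (Ico (n : ℝ≥0) (n + 1))) := by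
              gcongr; exact le_add_self
          _ ≤ 1 := ENNReal.inv_mul_le_one _
    _ = 2 := by rw [ENNReal.tsum_geometric, ENNReal.one_sub_inv_two, inv_inv]

/-- The density of `κ` with respect to `normalizedKernel κ`. -/
noncomputable def normalizedDensity (κ : Kernel Ω ℝ≥0) (ω : Ω) (s : ℝ≥0) : ℝ≥0 :=
  ((cellWeight κ ⌊s⌋₊ ω)⁻¹).toNNReal

theorem measurable_normalizedDensity (κ : Kernel Ω ℝ≥0) :
    Measurable (Function.uncurry (normalizedDensity κ)) := by
  have h : Measurable fun z : Ω × ℕ => ((cellWeight κ z.2 z.1)⁻¹).toNNReal :=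
    measurable_from_prod_countable_left fun n => (measurable_cellWeight κ n).inv.ennreal_toNNReal
  have h' : Measurable fun z : Ω × ℝ≥0 => (z.1, ⌊z.2⌋₊) :=
    measurable_fst.prodMk (Nat.measurable_floor.comp measurable_snd)
  have e : Function.uncurry (normalizedDensity κ)
      = (fun z : Ω × ℕ => ((cellWeight κ z.2 z.1)⁻¹).toNNReal) ∘ fun z => (z.1, ⌊z.2⌋₊) := rfl
  rw [e]
  exact h.comp h'

theorem withDensity_normalizedDensity (κ : Kernel Ω ℝ≥0) {ω : Ω}
    (hω : ∀ t, κ ω (Icc 0 t) < ∞) :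
    (normalizedKernel κ ω).withDensity (fun s => normalizedDensity κ ω s) = κ ω := by
  have hfin : ∀ n : ℕ, κ ω (Ico n (n + 1)) ≠ ∞ := fun n =>
    ((measure_mono (Ico_subset_Icc_self.trans (Icc_subset_Icc_left zero_le))).trans_lt
      (hω (n + 1))).ne
  have hw0 : ∀ n, cellWeight κ n ω ≠ 0 := fun n => by
    simp [cellWeight, hfin n]
  have hwt : ∀ n, cellWeight κ n ω ≠ ∞ := fun n => by
    simp [cellWeight, ENNReal.mul_eq_top]
  have hpart : ⋃ n : ℕ, Ico (n : ℝ≥0) (n + 1) = univ := by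
    exact eq_univ_of_forall fun s =>
      mem_iUnion.mpr ⟨⌊s⌋₊, Nat.floor_le zero_le, Nat.lt_floor_add_one s⟩
  have hdisj : Pairwise (Function.onFun Disjoint fun n : ℕ => Ico (n : ℝ≥0) (n + 1)) := by
    intro i j hij
    refine disjoint_left.mpr fun s hs hs' => hij ?_
    rw [← (Nat.floor_eq_iff zero_le).mpr hs, ← (Nat.floor_eq_iff zero_le).mpr hs']
  rw [normalizedKernel_apply, withDensity_sum]
  conv_rhs => rw [← Measure.restrict_univ (μ := κ ω), ← hpart,
    Measure.restrict_iUnion hdisj fun n => measurableSet_Ico]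
  congr 1
  funext n
  rw [withDensity_smul_measure]
  have : ((κ ω).restrict (Ico (n : ℝ≥0) (n + 1))).withDensity
      (fun s => (normalizedDensity κ ω s : ℝ≥0∞))
      = ((κ ω).restrict (Ico (n : ℝ≥0) (n + 1))).withDensity fun _ => (cellWeight κ n ω)⁻¹ := by
    refine withDensity_congr_ae ?_
    filter_upwards [ae_restrict_mem measurableSet_Ico] with s hs
    rw [normalizedDensity, (Nat.floor_eq_iff zero_le).mpr hs,
      ENNReal.coe_toNNReal (ENNReal.inv_ne_top.mpr (hw0 n))]
  rw [this, withDensity_const, smul_smul, ENNReal.mul_inv_cancel (hw0 n) (hwt n), one_smul]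

/-- Two random measures that are almost surely locally finite have jointly measurable densities
with respect to one finite kernel. -/
theorem exists_common_density (κ κ' : Kernel Ω ℝ≥0) {P : Measure Ω}
    (h : ∀ᵐ ω ∂P, ∀ t, κ ω (Icc 0 t) < ∞) (h' : ∀ᵐ ω ∂P, ∀ t, κ' ω (Icc 0 t) < ∞) :
    ∃ (m : Kernel Ω ℝ≥0) (w w' : Ω → ℝ≥0 → ℝ≥0), IsFiniteKernel m ∧
      Measurable (Function.uncurry w) ∧ Measurable (Function.uncurry w') ∧
      (∀ᵐ ω ∂P, κ ω = (m ω).withDensity fun s => w ω s) ∧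
      ∀ᵐ ω ∂P, κ' ω = (m ω).withDensity fun s => w' ω s := by
  set m := normalizedKernel κ + normalizedKernel κ' with hm
  have aux : ∀ κ₁ : Kernel Ω ℝ≥0, (∀ ω, normalizedKernel κ₁ ω ≪ m ω) →
      (∀ᵐ ω ∂P, ∀ t, κ₁ ω (Icc 0 t) < ∞) → ∃ w : Ω → ℝ≥0 → ℝ≥0, Measurable (Function.uncurry w) ∧
        ∀ᵐ ω ∂P, κ₁ ω = (m ω).withDensity fun s => w ω s := by
    intro κ₁ hac hfin
    have hr : Measurable (Function.uncurry ((normalizedKernel κ₁).rnDeriv m)) :=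
      Kernel.measurable_rnDeriv _ _
    refine ⟨fun ω s => ((normalizedKernel κ₁).rnDeriv m ω s).toNNReal * normalizedDensity κ₁ ω s,
      hr.ennreal_toNNReal.mul (measurable_normalizedDensity κ₁), ?_⟩
    filter_upwards [hfin] with ω hω
    have hrω : Measurable ((normalizedKernel κ₁).rnDeriv m ω) :=
      Kernel.measurable_rnDeriv_right _ _ _
    have hdω : Measurable fun s => (normalizedDensity κ₁ ω s : ℝ≥0∞) :=
      ((measurable_normalizedDensity κ₁).comp measurable_prodMk_left).coe_nnreal_ennreal
    have e1 : (m ω).withDensity ((normalizedKernel κ₁).rnDeriv m ω) = normalizedKernel κ₁ ω := by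
      rw [← Kernel.withDensity_apply _ (Kernel.measurable_rnDeriv _ _)]
      exact Kernel.withDensity_rnDeriv_eq (hac ω)
    conv_lhs => rw [← withDensity_normalizedDensity κ₁ hω, ← e1, ← withDensity_mul _ hrω hdω]
    refine withDensity_congr_ae ?_
    filter_upwards [(normalizedKernel κ₁).rnDeriv_ne_top m (a := ω)] with s hs
    rw [Pi.mul_apply, ENNReal.coe_mul, ENNReal.coe_toNNReal hs]
  obtain ⟨w, hw, hκ⟩ := aux κ (fun ω => by
    rw [hm, FunLike.coe_add, Pi.add_apply]
    exact (Measure.le_add_right le_rfl).absolutelyContinuous) h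
  obtain ⟨w', hw', hκ'⟩ := aux κ' (fun ω => by
    rw [hm, FunLike.coe_add, Pi.add_apply]
    exact (Measure.le_add_left le_rfl).absolutelyContinuous) h'
  exact ⟨m, w, w', inferInstance, hw, hw', hκ, hκ'⟩

end Kernel

/-! ### Second moment of the stochastic convolution -/

section HilbertBasis

theorem enorm_sq_eq_ofReal {E : Type*} [NormedAddCommGroup E] (x : E) :
    ‖x‖ₑ ^ 2 = ENNReal.ofReal (‖x‖ ^ 2) := by
  rw [← ofReal_norm, ENNReal.ofReal_pow (norm_nonneg _)]

/-- Parseval's identity in `[0, ∞]`. -/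
theorem tsum_enorm_inner_sq {E ι : Type*} [NormedAddCommGroup E] [InnerProductSpace ℝ E]
    (b : HilbertBasis ι ℝ E) (x : E) : ∑' i, ‖inner ℝ x (b i)‖ₑ ^ 2 = ‖x‖ₑ ^ 2 := by
  have h := b.hasSum_inner_mul_inner x x
  rw [real_inner_self_eq_norm_sq] at h
  have e : ∀ i, inner ℝ x (b i) * inner ℝ (b i) x = ‖inner ℝ x (b i)‖ ^ 2 := fun i => by
    rw [real_inner_comm, Real.norm_eq_abs, sq_abs, sq]
  simp only [e] at h
  simp only [enorm_sq_eq_ofReal]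
  rw [← ENNReal.ofReal_tsum_of_nonneg (fun i => by positivity) h.summable, h.tsum_eq]

theorem countable_of_orthonormal {E ι : Type*} [NormedAddCommGroup E] [InnerProductSpace ℝ E]
    [TopologicalSpace.SeparableSpace E] {v : ι → E} (hv : Orthonormal ℝ v) : Countable ι := by
  have hdisj : Pairwise (Function.onFun Disjoint fun i => Metric.ball (v i) (1 / 2)) := by
    intro i j hij
    refine Metric.ball_disjoint_ball ?_
    have h := norm_sub_sq_real (v i) (v j)
    rw [hv.1 i, hv.1 j, hv.2 hij] at h
    rw [dist_eq_norm]
    nlinarith [norm_nonneg (v i - v j)]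
  exact hdisj.countable_of_isOpen_disjoint (fun _ => Metric.isOpen_ball)
    fun i => ⟨v i, Metric.mem_ball_self (by norm_num)⟩

/-- The Hilbert-Schmidt norms of an operator and of its adjoint agree. -/
theorem tsum_enorm_adjoint_sq {K H ι κ : Type*} [NormedAddCommGroup K] [InnerProductSpace ℝ K]
    [CompleteSpace K] [NormedAddCommGroup H] [InnerProductSpace ℝ H] [CompleteSpace H]
    (b : HilbertBasis ι ℝ K) (e : HilbertBasis κ ℝ H) (B : K →L[ℝ] H) :
    ∑' j, ‖ContinuousLinearMap.adjoint B (e j)‖ₑ ^ 2 = ∑' i, ‖B (b i)‖ₑ ^ 2 := by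
  simp_rw [← tsum_enorm_inner_sq b (ContinuousLinearMap.adjoint B (e _)),
    ← tsum_enorm_inner_sq e (B (b _)), ContinuousLinearMap.adjoint_inner_left]
  rw [ENNReal.tsum_comm]
  simp_rw [real_inner_comm]

end HilbertBasis

section Noise

theorem IsWienerIntegral.tendsto_lintegral {Ω : Type*} [MeasurableSpace Ω]
    {P : Measure Ω} {K : Type*} {W : ℝ≥0 → K → Ω → ℝ} {f : ℝ≥0 → K} {t : ℝ≥0} {Y : Ω → ℝ}
    (hY : IsWienerIntegral P W f t Y) :
    Tendsto (fun n => ∫⁻ ω, ‖wienerSum W f t n ω - Y ω‖ₑ ^ 2 ∂P) atTop (𝓝 0) := by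
  have h := ((ENNReal.continuous_pow 2).tendsto 0).comp hY
  rw [zero_pow two_ne_zero] at h
  refine h.congr fun n => ?_
  have e := eLpNorm_nnreal_pow_eq_lintegral (μ := P) (p := 2)
    (f := fun ω => wienerSum W f t n ω - Y ω) two_ne_zero
  simp only [NNReal.coe_ofNat, ENNReal.rpow_ofNat] at e
  exact e

variable {Ω : Type*} [mΩ : MeasurableSpace Ω] {P : Measure Ω} {𝓕 : Filtration ℝ≥0 mΩ}
  {K : Type*} [NormedAddCommGroup K] [InnerProductSpace ℝ K] {W : ℝ≥0 → K → Ω → ℝ}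

theorem IsCylindricalWiener.measurable (hW : IsCylindricalWiener P 𝓕 W) (t : ℝ≥0) (k : K) :
    Measurable (W t k) := ((hW.adapted t k).mono (𝓕.le t)).measurable

theorem IsCylindricalWiener.measurable_wienerSum (hW : IsCylindricalWiener P 𝓕 W)
    (f : ℝ≥0 → K) (t : ℝ≥0) (n : ℕ) : Measurable (wienerSum W f t n) :=
  Finset.measurable_fun_sum _ fun _ _ => (hW.measurable _ _).sub (hW.measurable _ _)

/-- The Itô isometry for Riemann-Itô sums; the increments are centred and pairwise independent. -/
theorem IsCylindricalWiener.lintegral_wienerSum_sq [IsProbabilityMeasure P]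
    (hW : IsCylindricalWiener P 𝓕 W) (f : ℝ≥0 → K) (t : ℝ≥0) (n : ℕ) :
    ∫⁻ ω, ‖wienerSum W f t n ω‖ₑ ^ 2 ∂P
      = ∑ i ∈ Finset.range n, (t / n : ℝ≥0) * ‖f (t * (i / n))‖ₑ ^ 2 := by
  set X : ℕ → Ω → ℝ := fun i ω =>
    W (t * ((i + 1 : ℕ) / n)) (f (t * (i / n))) ω - W (t * (i / n)) (f (t * (i / n))) ω with hX
  have hle : ∀ i j : ℕ, i ≤ j → t * ((i : ℝ≥0) / n) ≤ t * ((j : ℝ≥0) / n) := fun i j hij => by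
    gcongr
  have hlaw : ∀ i, HasLaw (X i) (gaussianReal 0 ((t / n) * ‖f (t * (i / n))‖₊ ^ 2)) P := by
    intro i
    have h := hW.law_increment (t * ((i : ℝ≥0) / n)) (t * (((i + 1 : ℕ) : ℝ≥0) / n))
      (f (t * (i / n))) (hle i _ i.le_succ)
    have e : t * (((i + 1 : ℕ) : ℝ≥0) / n) - t * ((i : ℝ≥0) / n) = t / n := by
      rw [← mul_tsub, ← tsub_div, ← Nat.cast_tsub]
      simp [div_eq_mul_inv]
    rwa [e] at h
  have hmem : ∀ i, MemLp (X i) 2 P := by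
    intro i
    have hp := memLp_id_gaussianReal' (μ := 0) (v := (t / n) * ‖f (t * (i / n))‖₊ ^ 2) 2 (by simp)
    rw [← (hlaw i).map_eq] at hp
    exact hp.comp_of_map (hlaw i).aemeasurable
  have hmean : ∀ i, ∫ ω, X i ω ∂P = 0 := fun i => by
    rw [(hlaw i).integral_eq, integral_id_gaussianReal]
  have hindep : ∀ i j, i < j → X i ⟂ᵢ[P] X j := by
    intro i j hij
    rw [IndepFun_iff_Indep]
    refine (indep_of_indep_of_le_right (hW.indep_increment (t * ((j : ℝ≥0) / n))
      (t * (((j + 1 : ℕ) : ℝ≥0) / n)) (f (t * (j / n))) (hle j _ j.le_succ)) ?_).symm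
    refine Measurable.comap_le ?_
    exact ((hW.adapted _ _).mono (𝓕.mono (hle (i + 1) j hij))).measurable.sub
      ((hW.adapted _ _).mono (𝓕.mono (hle i j hij.le))).measurable
  have hsum : wienerSum W f t n = ∑ i ∈ Finset.range n, X i := by
    funext ω; simp [wienerSum, X]
  have hmeanS : ∫ ω, wienerSum W f t n ω ∂P = 0 := by
    rw [hsum]
    simp only [Finset.sum_apply]
    rw [integral_finsetSum _ fun i _ => (hmem i).integrable one_le_two]
    simp [hmean]
  have hmemS : MemLp (wienerSum W f t n) 2 P := by
    rw [hsum]; exact memLp_finsetSum' _ fun i _ => hmem i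
  have h1 : ∫⁻ ω, ‖wienerSum W f t n ω‖ₑ ^ 2 ∂P = evariance (wienerSum W f t n) P := by
    simp [evariance, hmeanS]
  rw [h1, ← ofReal_variance hmemS, hsum, IndepFun.variance_sum (fun i _ => hmem i),
    ENNReal.ofReal_sum_of_nonneg fun i _ => variance_nonneg _ _]
  · refine Finset.sum_congr rfl fun i _ => ?_
    rw [(hlaw i).variance_eq, variance_id_gaussianReal, ENNReal.ofReal_coe_nnreal]
    simp [enorm]
  · intro i _ j _ hij
    rcases lt_or_gt_of_ne hij with h | h
    · exact hindep i j h
    · exact (hindep j i h).symm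

variable {H : Type*} [NormedAddCommGroup H] [InnerProductSpace ℝ H] [CompleteSpace H]
  [CompleteSpace K]

theorem enorm_sq_le_two_mul (a b : ℝ) : ‖b‖ₑ ^ 2 ≤ 2 * ‖a‖ₑ ^ 2 + 2 * ‖a - b‖ₑ ^ 2 := by
  simp only [enorm_sq_eq_ofReal]
  rw [show (2 : ℝ≥0∞) = ENNReal.ofReal 2 by simp, ← ENNReal.ofReal_mul (by norm_num),
    ← ENNReal.ofReal_mul (by norm_num), ← ENNReal.ofReal_add (by positivity) (by positivity)]
  refine ENNReal.ofReal_le_ofReal ?_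
  simp only [Real.norm_eq_abs, sq_abs]
  nlinarith [sq_nonneg (2 * a - b)]

/-- The second moment of the stochastic convolution grows at most linearly in time. The factor `2`
comes from comparing with Riemann-Itô sums by the parallelogram inequality. -/
theorem IsStochasticConvolution.lintegral_sq_le [IsProbabilityMeasure P]
    [TopologicalSpace.SeparableSpace H]
    (hW : IsCylindricalWiener P 𝓕 W) {S : ℝ≥0 → H →L[ℝ] H} (hS : ∀ t x, ‖S t x‖ ≤ ‖x‖)
    {σ : K →L[ℝ] H} {Z : ℝ≥0 → Ω → H} (hZ : IsStochasticConvolution P W S σ Z)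
    {ι : Type*} (b : HilbertBasis ι ℝ K) (t : ℝ≥0) :
    ∫⁻ ω, ‖Z t ω‖ₑ ^ 2 ∂P ≤ 2 * t * ∑' i, ‖σ (b i)‖ₑ ^ 2 := by
  obtain ⟨κ, e, he⟩ := exists_hilbertBasis ℝ H
  have : Countable κ := countable_of_orthonormal e.orthonormal
  set T := ∑' i, ‖σ (b i)‖ₑ ^ 2 with hT
  have hZt : StronglyMeasurable (Z t) := hZ.measurable.comp_measurable measurable_prodMk_left
  have hYm : ∀ j, Measurable fun ω => inner ℝ (Z t ω) (e j) := fun j =>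
    (hZt.inner stronglyMeasurable_const).measurable
  have h1 : ∫⁻ ω, ‖Z t ω‖ₑ ^ 2 ∂P = ∑' j, ∫⁻ ω, ‖inner ℝ (Z t ω) (e j)‖ₑ ^ 2 ∂P := by
    rw [← lintegral_tsum fun j => ((hYm j).enorm.pow_const 2).aemeasurable]
    simp_rw [tsum_enorm_inner_sq e]
  rw [h1, ENNReal.tsum_eq_iSup_sum]
  refine iSup_le fun J => ?_
  set g : κ → ℝ≥0 → K := fun j s => ContinuousLinearMap.adjoint ((S (t - s)).comp σ) (e j) with hg
  have htrace : ∀ s, ∑ j ∈ J, ‖g j s‖ₑ ^ 2 ≤ T := by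
    intro s
    calc ∑ j ∈ J, ‖g j s‖ₑ ^ 2 ≤ ∑' j, ‖g j s‖ₑ ^ 2 := ENNReal.sum_le_tsum J
      _ = ∑' i, ‖(S (t - s)).comp σ (b i)‖ₑ ^ 2 := tsum_enorm_adjoint_sq b e _
      _ ≤ T := by
        refine ENNReal.tsum_le_tsum fun i => ?_
        gcongr
        exact enorm_le_iff_norm_le.mpr (hS _ _)
  have hbound : ∀ n, ∑ j ∈ J, ∫⁻ ω, ‖inner ℝ (Z t ω) (e j)‖ₑ ^ 2 ∂P ≤ 2 * t * T
      + ∑ j ∈ J, 2 * ∫⁻ ω, ‖wienerSum W (g j) t n ω - inner ℝ (Z t ω) (e j)‖ₑ ^ 2 ∂P := by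
    intro n
    have hj : ∀ j, ∫⁻ ω, ‖inner ℝ (Z t ω) (e j)‖ₑ ^ 2 ∂P
        ≤ 2 * (∑ i ∈ Finset.range n, (t / n : ℝ≥0) * ‖g j (t * (i / n))‖ₑ ^ 2)
          + 2 * ∫⁻ ω, ‖wienerSum W (g j) t n ω - inner ℝ (Z t ω) (e j)‖ₑ ^ 2 ∂P := by
      intro j
      rw [← hW.lintegral_wienerSum_sq, ← lintegral_const_mul _ (by
          exact (hW.measurable_wienerSum _ _ _).enorm.pow_const 2),
        ← lintegral_const_mul _ (by
          exact ((hW.measurable_wienerSum _ _ _).sub (hYm j)).enorm.pow_const 2),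
        ← lintegral_add_left (by
          exact ((hW.measurable_wienerSum _ _ _).enorm.pow_const 2).const_mul _)]
      exact lintegral_mono fun ω => enorm_sq_le_two_mul _ _
    refine (Finset.sum_le_sum fun j _ => hj j).trans ?_
    rw [Finset.sum_add_distrib]
    gcongr
    rw [← Finset.mul_sum, Finset.sum_comm, mul_assoc]
    gcongr
    simp only [← Finset.mul_sum _ _ (((t / n : ℝ≥0) : ℝ≥0∞))]
    calc ((t / n : ℝ≥0) : ℝ≥0∞) * ∑ i ∈ Finset.range n, ∑ j ∈ J, ‖g j (t * (i / n))‖ₑ ^ 2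
        ≤ ((t / n : ℝ≥0) : ℝ≥0∞) * ∑ i ∈ Finset.range n, T := by
          gcongr; exact htrace _
      _ ≤ t * T := by
          rw [Finset.sum_const, Finset.card_range, nsmul_eq_mul, ← mul_assoc]
          gcongr
          rw [← ENNReal.coe_natCast, ← ENNReal.coe_mul, ENNReal.coe_le_coe]
          rcases eq_or_ne n 0 with rfl | hn
          · simp
          · rw [div_mul_cancel₀ _ (Nat.cast_ne_zero.mpr hn)]
  refine ge_of_tendsto' (x := atTop) (b := _) ?_ hbound
  have h0 : Tendsto (fun n => ∑ j ∈ J,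
      2 * ∫⁻ ω, ‖wienerSum W (g j) t n ω - inner ℝ (Z t ω) (e j)‖ₑ ^ 2 ∂P) atTop (𝓝 0) := by
    have := tendsto_finsetSum J fun j _ => ENNReal.Tendsto.const_mul (a := 2)
      (hZ.inner_eq t (e j)).tendsto_lintegral (Or.inr (by simp))
    rwa [mul_zero, Finset.sum_const_zero] at this
  simpa using tendsto_const_nhds.add h0

end Noise

/-! ### Densities of controls -/

section Order

variable {D : Type*} [MeasurableSpace D] {μ : Measure D}

/-- As `q ≥ q₀ > 0`, a denominator `⟨q, v⟩` vanishes on the nonnegative cone only at `v = 0`. -/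
theorem inner_pos_of_nonneg_of_ne_zero [IsFiniteMeasure μ] {q : StateSpace μ} {q₀ : ℝ}
    (hq₀ : 0 < q₀) (hq : ∀ᵐ ξ ∂μ, q₀ ≤ q ξ) {v : StateSpace μ} (hv : 0 ≤ v) (hv0 : v ≠ 0) :
    0 < inner ℝ q v := by
  have hv' : 0 ≤ᵐ[μ] v := (Lp.coeFn_nonneg v).mpr hv
  have hint := L2.integrable_inner (𝕜 := ℝ) q v
  rw [L2.inner_def]
  have hnn : 0 ≤ᵐ[μ] fun ξ => inner ℝ (q ξ) (v ξ) := by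
    filter_upwards [hv', hq] with ξ h1 h2
    simp only [RCLike.inner_apply, conj_trivial, Pi.zero_apply] at h1 ⊢
    exact mul_nonneg h1 (hq₀.le.trans h2)
  rw [integral_pos_iff_support_of_nonneg_ae hnn hint, pos_iff_ne_zero]
  intro h0
  refine hv0 ((Lp.eq_zero_iff_ae_eq_zero).mpr ?_)
  have : ∀ᵐ ξ ∂μ, inner ℝ (q ξ) (v ξ) = 0 := by
    rw [ae_iff]; exact h0
  filter_upwards [this, hq] with ξ h1 h2
  simp only [RCLike.inner_apply, conj_trivial, mul_eq_zero] at h1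
  exact h1.resolve_right (hq₀.trans_le h2).ne'

theorem inner_nonneg_of_nonneg [IsFiniteMeasure μ] {q : StateSpace μ} {q₀ : ℝ}
    (hq₀ : 0 < q₀) (hq : ∀ᵐ ξ ∂μ, q₀ ≤ q ξ) {v : StateSpace μ} (hv : 0 ≤ v) :
    0 ≤ inner ℝ q v := by
  rcases eq_or_ne v 0 with rfl | hv0
  · simp
  · exact (inner_pos_of_nonneg_of_ne_zero hq₀ hq hv hv0).le

/-- Joint convexity and homogeneity of `(r, A) ↦ r² / A`, with `0 / 0 = 0`. -/
theorem sq_div_add_le {a b r s A B : ℝ} (ha : 0 ≤ a) (hb : 0 ≤ b) (hA : 0 ≤ A) (hB : 0 ≤ B)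
    (hrA : A = 0 → r = 0) (hsB : B = 0 → s = 0) :
    (a * r + b * s) ^ 2 / (a * A + b * B) ≤ a * (r ^ 2 / A) + b * (s ^ 2 / B) := by
  rcases (add_nonneg (mul_nonneg ha hA) (mul_nonneg hb hB)).eq_or_lt with h | h
  · rw [← h, div_zero]; positivity
  rw [div_le_iff₀ h]
  have hr : r = r / A * A := by
    rcases eq_or_ne A 0 with h0 | h0
    · simp [hrA h0]
    · field_simp
  have hs : s = s / B * B := by
    rcases eq_or_ne B 0 with h0 | h0
    · simp [hsB h0]
    · field_simp
  set p := r / A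
  set p' := s / B
  have e1 : r ^ 2 / A = p ^ 2 * A := by
    rcases eq_or_ne A 0 with h0 | h0
    · simp [h0]
    · rw [hr]; field_simp
  have e2 : s ^ 2 / B = p' ^ 2 * B := by
    rcases eq_or_ne B 0 with h0 | h0
    · simp [h0]
    · rw [hs]; field_simp
  rw [e1, e2, hr, hs]
  have := mul_nonneg (mul_nonneg (mul_nonneg ha hb) (mul_nonneg hA hB)) (sq_nonneg (p - p'))
  nlinarith

/-- The integrand `‖v‖² / ⟨q, v⟩` of the second moment condition on controls is sublinear on the
nonnegative cone. -/
theorem sq_norm_div_inner_add_le [IsFiniteMeasure μ] {q : StateSpace μ} {q₀ : ℝ}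
    (hq₀ : 0 < q₀) (hq : ∀ᵐ ξ ∂μ, q₀ ≤ q ξ) (a b : ℝ≥0) {v w : StateSpace μ} (hv : 0 ≤ v)
    (hw : 0 ≤ w) :
    ENNReal.ofReal (‖a • v + b • w‖ ^ 2 / inner ℝ q (a • v + b • w))
      ≤ a * ENNReal.ofReal (‖v‖ ^ 2 / inner ℝ q v)
        + b * ENNReal.ofReal (‖w‖ ^ 2 / inner ℝ q w) := by
  have hz : ∀ u : StateSpace μ, 0 ≤ u → inner ℝ q u = 0 → ‖u‖ = 0 := fun u hu h0 => by
    by_contra hne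
    exact (inner_pos_of_nonneg_of_ne_zero hq₀ hq hu (norm_ne_zero_iff.mp hne)).ne' h0
  have hqv := inner_nonneg_of_nonneg hq₀ hq hv
  have hqw := inner_nonneg_of_nonneg hq₀ hq hw
  rw [← ENNReal.ofReal_coe_nnreal (p := a), ← ENNReal.ofReal_coe_nnreal (p := b),
    ← ENNReal.ofReal_mul a.coe_nonneg, ← ENNReal.ofReal_mul b.coe_nonneg,
    ← ENNReal.ofReal_add (by positivity) (by positivity)]
  refine ENNReal.ofReal_le_ofReal (le_trans ?_ (sq_div_add_le a.2 b.2 hqv hqw (hz v hv) (hz w hw)))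
  rw [inner_add_right, NNReal.smul_def, NNReal.smul_def, real_inner_smul_right,
    real_inner_smul_right]
  have hnorm : ‖(a : ℝ) • v + (b : ℝ) • w‖ ≤ a * ‖v‖ + b * ‖w‖ := by
    refine (norm_add_le _ _).trans (le_of_eq ?_)
    rw [norm_smul, norm_smul, Real.norm_of_nonneg a.coe_nonneg, Real.norm_of_nonneg b.coe_nonneg]
  have : 0 ≤ (a : ℝ) * inner ℝ q v + b * inner ℝ q w := by positivity
  exact div_le_div_of_nonneg_right (pow_le_pow_left₀ (norm_nonneg _) hnorm 2) this

end Order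

section Density

variable {D : Type*} [MeasurableSpace D] {Ω : Type*} [mΩ : MeasurableSpace Ω]
  {μ : Measure D} {P : Measure Ω} {𝓕 : Filtration ℝ≥0 mΩ}
  {Δ : PointedCone ℝ (StateSpace μ)} {q : StateSpace μ}

namespace AdmissibleControl

theorem toFun_eq_integral (I : AdmissibleControl P 𝓕 Δ q) :
    ∀ᵐ ω ∂P, (fun t => I.toFun t ω) = fun t => ∫ s in Icc 0 t, I.dir s ω ∂(I.var ω) := by
  filter_upwards [I.eq_integral] with ω h using funext h

/-- The variation measure of a control is almost surely locally finite. -/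
theorem var_Icc_lt_top (I : AdmissibleControl P 𝓕 Δ q) : ∀ᵐ ω ∂P, ∀ t, I.var ω (Icc 0 t) < ∞ := by
  filter_upwards [I.var_eq, I.dir_integrable, I.toFun_eq_integral] with ω h1 h2 h3 t
  rw [h1, h3, congrFun h3 0]
  exact (variation_cumulative_le h2 t).trans_lt (h2 t).2

/-- `w` is a jointly measurable density of the variation measure of `I` with respect to `m`. -/
structure HasVarDensity (I : AdmissibleControl P 𝓕 Δ q) (m : Kernel Ω ℝ≥0)
    (w : Ω → ℝ≥0 → ℝ≥0) : Prop where
  measurable : Measurable (Function.uncurry w)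
  var_eq : ∀ᵐ ω ∂P, I.var ω = (m ω).withDensity fun s => w ω s

/-- The density `w ϑ̂` of `dI` with respect to a measure for which `|I|` has density `w`. -/
noncomputable def scaledDir (I : AdmissibleControl P 𝓕 Δ q) (w : Ω → ℝ≥0 → ℝ≥0) (s : ℝ≥0) (ω : Ω) :
    StateSpace μ := w ω s • I.dir s ω

theorem scaledDir_nonneg (I : AdmissibleControl P 𝓕 Δ q) (w : Ω → ℝ≥0 → ℝ≥0) :
    ∀ᵐ ω ∂P, ∀ t, 0 ≤ I.scaledDir w t ω := by
  filter_upwards [I.dir_nonneg] with ω h1 t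
  have := (Lp.coeFn_nonneg _).mpr (h1 t)
  refine (Lp.coeFn_nonneg _).mp ?_
  have e : (I.scaledDir w t ω : D → ℝ) =ᵐ[μ] (w ω t : ℝ) • ⇑(I.dir t ω) := Lp.coeFn_smul _ _
  filter_upwards [this, e] with ξ h2 h3
  rw [h3]
  exact mul_nonneg (w ω t).2 h2

theorem exists_hasVarDensity (I J : AdmissibleControl P 𝓕 Δ q) :
    ∃ (m : Kernel Ω ℝ≥0) (w w' : Ω → ℝ≥0 → ℝ≥0), IsFiniteKernel m ∧
      I.HasVarDensity m w ∧ J.HasVarDensity m w' := by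
  obtain ⟨m, w, w', hm, hw, hw', h, h'⟩ := exists_common_density I.var J.var I.var_Icc_lt_top
    J.var_Icc_lt_top
  exact ⟨m, w, w', hm, ⟨hw, h⟩, hw', h'⟩

namespace HasVarDensity

variable {I : AdmissibleControl P 𝓕 Δ q} {m : Kernel Ω ℝ≥0} {w : Ω → ℝ≥0 → ℝ≥0}

theorem stronglyMeasurable_scaledDir (h : I.HasVarDensity m w) :
    StronglyMeasurable (Function.uncurry (I.scaledDir w)) := by
  have h1 : Measurable fun z : ℝ≥0 × Ω => ((w z.2 z.1 : ℝ≥0) : ℝ) :=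
    (h.measurable.comp measurable_swap).coe_nnreal_real
  exact h1.stronglyMeasurable.smul I.dir_measurable

theorem measurable_section (h : I.HasVarDensity m w) (ω : Ω) : Measurable (w ω) :=
  h.measurable.comp measurable_prodMk_left

theorem integrableOn_scaledDir (h : I.HasVarDensity m w) :
    ∀ᵐ ω ∂P, ∀ t, IntegrableOn (fun s => I.scaledDir w s ω) (Icc 0 t) (m ω) := by
  filter_upwards [h.var_eq, I.dir_integrable] with ω h1 h2 t
  have := h2 t
  rwa [h1, IntegrableOn, restrict_withDensity measurableSet_Icc,
    integrable_withDensity_iff_integrable_smul (h.measurable_section ω)] at this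

theorem setIntegral_eq (h : I.HasVarDensity m w) : ∀ᵐ ω ∂P, ∀ t,
    ∀ T : ℝ≥0 → StateSpace μ →L[ℝ] StateSpace μ,
      ∫ s in Icc 0 t, T s (I.dir s ω) ∂(I.var ω)
        = ∫ s in Icc 0 t, T s (I.scaledDir w s ω) ∂(m ω) := by
  filter_upwards [h.var_eq] with ω h1 t T
  rw [h1, setIntegral_withDensity_eq_setIntegral_smul (h.measurable_section ω) _ measurableSet_Icc]
  simp only [scaledDir, NNReal.smul_def, map_smul]

theorem toFun_eq (h : I.HasVarDensity m w) : ∀ᵐ ω ∂P, ∀ t,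
    I.toFun t ω = ∫ s in Icc 0 t, I.scaledDir w s ω ∂(m ω) := by
  filter_upwards [h.setIntegral_eq, I.eq_integral] with ω h1 h2 t
  rw [h2]
  exact h1 t fun _ => ContinuousLinearMap.id ℝ _

theorem setLIntegral_eq (h : I.HasVarDensity m w) {ψ : ℝ≥0 → StateSpace μ → ℝ≥0∞}
    (hψ : ∀ s (c : ℝ≥0) v, ψ s (c • v) = c * ψ s v)
    (hm : Measurable fun z : ℝ≥0 × Ω => ψ z.1 (I.dir z.1 z.2)) : ∀ᵐ ω ∂P, ∀ B : Set ℝ≥0,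
    MeasurableSet B →
      ∫⁻ s in B, ψ s (I.dir s ω) ∂(I.var ω) = ∫⁻ s in B, ψ s (I.scaledDir w s ω) ∂(m ω) := by
  filter_upwards [h.var_eq] with ω h1 B hB
  have hmω : Measurable fun s => ψ s (I.dir s ω) := hm.comp measurable_prodMk_right
  rw [h1, setLIntegral_withDensity_eq_setLIntegral_mul _
    (h.measurable_section ω).coe_nnreal_ennreal hmω hB]
  simp only [Pi.mul_apply, scaledDir, hψ]

end HasVarDensity

end AdmissibleControl

end Density

section Homogeneous

variable {H : Type*} [NormedAddCommGroup H] [InnerProductSpace ℝ H]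

theorem enorm_nnreal_smul (c : ℝ≥0) (v : H) : ‖c • v‖ₑ = c * ‖v‖ₑ := by
  rw [NNReal.smul_def, enorm_smul]; simp

theorem ofReal_sq_norm_div_inner_smul (q : H) (c : ℝ≥0) (v : H) :
    ENNReal.ofReal (‖c • v‖ ^ 2 / inner ℝ q (c • v))
      = c * ENNReal.ofReal (‖v‖ ^ 2 / inner ℝ q v) := by
  rw [← ENNReal.ofReal_coe_nnreal (p := c), ← ENNReal.ofReal_mul c.coe_nonneg, NNReal.smul_def,
    norm_smul, real_inner_smul_right, Real.norm_of_nonneg c.coe_nonneg]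
  congr 1
  rcases eq_or_ne (c : ℝ) 0 with h | h
  · simp [h]
  · rw [mul_pow, mul_div_mul_comm, sq, mul_div_assoc, div_self h, mul_one]

theorem ofReal_mul_inner_smul (q : H) (r : ℝ) (c : ℝ≥0) (v : H) :
    ENNReal.ofReal (r * inner ℝ q (c • v)) = c * ENNReal.ofReal (r * inner ℝ q v) := by
  rw [← ENNReal.ofReal_coe_nnreal (p := c), ← ENNReal.ofReal_mul c.coe_nonneg, NNReal.smul_def,
    real_inner_smul_right]
  congr 1; ring

/-- The polar decomposition of a vector; the junk value `0⁻¹ = 0` is harmless at `v = 0`. -/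
theorem nnnorm_smul_inv_nnnorm_smul (v : H) : ‖v‖₊ • (‖v‖₊⁻¹ • v) = v := by
  rcases eq_or_ne v 0 with rfl | h
  · simp
  · rw [smul_smul, mul_inv_cancel₀ (nnnorm_ne_zero_iff.mpr h), one_smul]

end Homogeneous

/-! ### Combinations of controls -/

section Combination

variable {D : Type*} [MeasurableSpace D] {Ω : Type*} [mΩ : MeasurableSpace Ω]
  {μ : Measure D} {P : Measure Ω} {𝓕 : Filtration ℝ≥0 mΩ}
  {Δ : PointedCone ℝ (StateSpace μ)} {q : StateSpace μ}

theorem nnreal_smul_nonneg {v : StateSpace μ} (c : ℝ≥0) (hv : 0 ≤ v) : 0 ≤ c • v := by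
  have h := (Lp.coeFn_nonneg _).mpr hv
  refine (Lp.coeFn_nonneg _).mp ?_
  have e : ((c • v : StateSpace μ) : D → ℝ) =ᵐ[μ] (c : ℝ) • ⇑v := Lp.coeFn_smul _ _
  filter_upwards [h, e] with ξ h2 h3
  rw [h3]
  exact mul_nonneg c.2 h2

/-- The normalized direction `η / ‖η‖` of a density `η`, equal to `0` where `η` vanishes. -/
noncomputable def polarDir (η : ℝ≥0 → Ω → StateSpace μ) (s : ℝ≥0) (ω : Ω) : StateSpace μ :=
  ‖η s ω‖₊⁻¹ • η s ω

theorem stronglyMeasurable_polarDir {η : ℝ≥0 → Ω → StateSpace μ}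
    (hη : StronglyMeasurable (Function.uncurry η)) :
    StronglyMeasurable (Function.uncurry (polarDir η)) := by
  have h : Measurable fun z : ℝ≥0 × Ω => ((‖Function.uncurry η z‖₊⁻¹ : ℝ≥0) : ℝ) :=
    hη.nnnorm.measurable.inv.coe_nnreal_real
  exact h.stronglyMeasurable.smul hη

/-- The random measure `‖η‖ dm`, which is the variation measure of `η dm`. -/
noncomputable def polarVar (m : Kernel Ω ℝ≥0) [IsFiniteKernel m] (η : ℝ≥0 → Ω → StateSpace μ) :
    Kernel Ω ℝ≥0 := m.withDensity fun ω s => ‖η s ω‖ₑ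

theorem polarVar_apply (m : Kernel Ω ℝ≥0) [IsFiniteKernel m] {η : ℝ≥0 → Ω → StateSpace μ}
    (hη : StronglyMeasurable (Function.uncurry η)) (ω : Ω) :
    polarVar m η ω = (m ω).withDensity fun s => (‖η s ω‖₊ : ℝ≥0∞) := by
  rw [polarVar, Kernel.withDensity_apply]
  · rfl
  · exact (hη.comp_measurable measurable_swap).enorm

theorem stronglyMeasurable_section {η : ℝ≥0 → Ω → StateSpace μ}
    (hη : StronglyMeasurable (Function.uncurry η)) (ω : Ω) :
    StronglyMeasurable fun s => η s ω := hη.comp_measurable measurable_prodMk_right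

theorem setIntegral_polarDir (m : Kernel Ω ℝ≥0) [IsFiniteKernel m] {η : ℝ≥0 → Ω → StateSpace μ}
    (hη : StronglyMeasurable (Function.uncurry η)) (ω : Ω) {B : Set ℝ≥0} (hB : MeasurableSet B) :
    ∫ s in B, polarDir η s ω ∂(polarVar m η ω) = ∫ s in B, η s ω ∂(m ω) := by
  rw [polarVar_apply m hη, setIntegral_withDensity_eq_setIntegral_smul
    (stronglyMeasurable_section hη ω).nnnorm.measurable _ hB]
  simp only [polarDir, nnnorm_smul_inv_nnnorm_smul]

theorem setLIntegral_polarDir (m : Kernel Ω ℝ≥0) [IsFiniteKernel m] {η : ℝ≥0 → Ω → StateSpace μ}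
    (hη : StronglyMeasurable (Function.uncurry η)) (ω : Ω) {ψ : StateSpace μ → ℝ≥0∞}
    (hψ : ∀ (c : ℝ≥0) v, ψ (c • v) = c * ψ v)
    (hm : Measurable fun s => ψ (polarDir η s ω)) {B : Set ℝ≥0} (hB : MeasurableSet B) :
    ∫⁻ s in B, ψ (polarDir η s ω) ∂(polarVar m η ω) = ∫⁻ s in B, ψ (η s ω) ∂(m ω) := by
  rw [polarVar_apply m hη, setLIntegral_withDensity_eq_setLIntegral_mul _
    (stronglyMeasurable_section hη ω).nnnorm.measurable.coe_nnreal_ennreal hm hB]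
  simp only [Pi.mul_apply, ← hψ, polarDir, nnnorm_smul_inv_nnnorm_smul]

theorem integrableOn_polarDir (m : Kernel Ω ℝ≥0) [IsFiniteKernel m] {η : ℝ≥0 → Ω → StateSpace μ}
    (hη : StronglyMeasurable (Function.uncurry η)) (ω : Ω) {B : Set ℝ≥0} (hB : MeasurableSet B)
    (h : IntegrableOn (fun s => η s ω) B (m ω)) :
    IntegrableOn (fun s => polarDir η s ω) B (polarVar m η ω) := by
  rw [polarVar_apply m hη, IntegrableOn, restrict_withDensity hB,
    integrable_withDensity_iff_integrable_smul
      (stronglyMeasurable_section hη ω).nnnorm.measurable]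
  simp only [polarDir, nnnorm_smul_inv_nnnorm_smul]
  exact h

/-- The admissible control with density `η` with respect to a finite kernel `m`; its variation
measure and polar density are `‖η‖ dm` and `η / ‖η‖`. -/
noncomputable def AdmissibleControl.ofDensity (m : Kernel Ω ℝ≥0) [IsFiniteKernel m]
    (η : ℝ≥0 → Ω → StateSpace μ) (X : ℝ≥0 → Ω → StateSpace μ)
    (hη : StronglyMeasurable (Function.uncurry η))
    (hadapted : ∀ t, StronglyMeasurable[𝓕 t] (X t))
    (hcadlag : ∀ᵐ ω ∂P, IsCadlag fun t => X t ω)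
    (hincr : ∀ᵐ ω ∂P, ∀ s t, s ≤ t → X t ω - valueBefore (fun r => X r ω) s ∈ Δ)
    (hnonneg : ∀ᵐ ω ∂P, ∀ t, 0 ≤ η t ω)
    (hint : ∀ᵐ ω ∂P, ∀ t, IntegrableOn (fun s => η s ω) (Icc 0 t) (m ω))
    (heq : ∀ᵐ ω ∂P, ∀ t, X t ω = ∫ s in Icc 0 t, η s ω ∂(m ω))
    (hsq : ∀ T, ∫⁻ ω, (∫⁻ s in Icc 0 T, ‖η s ω‖ₑ ∂(m ω)) ^ 2 ∂P < ∞)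
    (hratio : ∀ T, ∫⁻ ω, ∫⁻ s in Icc 0 T,
      ENNReal.ofReal (‖η s ω‖ ^ 2 / inner ℝ q (η s ω)) ∂(m ω) ∂P < ∞) :
    AdmissibleControl P 𝓕 Δ q where
  toFun := X
  var := polarVar m η
  dir := polarDir η
  adapted := hadapted
  cadlag := hcadlag
  increment_mem := hincr
  var_eq := by
    filter_upwards [hint, heq] with ω h1 h2 t
    have e : (fun t => X t ω) = fun t => ∫ s in Icc 0 t, η s ω ∂(m ω) := funext h2
    rw [e, h2 0, variation_cumulative_eq h1 t, polarVar_apply m hη,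
      withDensity_apply _ measurableSet_Icc]
    rfl
  dir_measurable := stronglyMeasurable_polarDir hη
  dir_nonneg := by
    filter_upwards [hnonneg] with ω h t
    exact nnreal_smul_nonneg _ (h t)
  dir_integrable := by
    filter_upwards [hint] with ω h t
    exact integrableOn_polarDir m hη ω measurableSet_Icc (h t)
  eq_integral := by
    filter_upwards [heq] with ω h t
    rw [h, setIntegral_polarDir m hη ω measurableSet_Icc]
  moment_sq T := by
    have hm := fun ω => (stronglyMeasurable_section (stronglyMeasurable_polarDir hη) ω).enorm
    simpa only [setLIntegral_polarDir m hη _ enorm_nnreal_smul (hm _) measurableSet_Icc]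
      using hsq T
  moment_ratio T := by
    have hm : ∀ ω, Measurable fun s => ENNReal.ofReal
        (‖polarDir η s ω‖ ^ 2 / inner ℝ q (polarDir η s ω)) := fun ω => by
      have h := stronglyMeasurable_section (stronglyMeasurable_polarDir hη) ω
      exact ((h.norm.measurable.pow_const 2).div
        (stronglyMeasurable_const.inner h).measurable).ennreal_ofReal
    simpa only [setLIntegral_polarDir m hη _
      (ψ := fun v => ENNReal.ofReal (‖v‖ ^ 2 / inner ℝ q v))
      (ofReal_sq_norm_div_inner_smul q) (hm _) measurableSet_Icc] using hratio T

theorem AdmissibleControl.hasVarDensity_ofDensity (m : Kernel Ω ℝ≥0) [IsFiniteKernel m]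
    {η : ℝ≥0 → Ω → StateSpace μ} (hη : StronglyMeasurable (Function.uncurry η))
    {I : AdmissibleControl P 𝓕 Δ q} (hI : I.var = polarVar m η) :
    I.HasVarDensity m fun ω s => ‖η s ω‖₊ where
  measurable := (hη.comp_measurable measurable_swap).nnnorm.measurable
  var_eq := Eventually.of_forall fun ω => by rw [hI, polarVar_apply m hη]

/-- The control `I = 0`. -/
noncomputable def AdmissibleControl.zero : AdmissibleControl P 𝓕 Δ q :=
  AdmissibleControl.ofDensity 0 (fun _ _ => 0) (fun _ _ => 0) stronglyMeasurable_const
    (fun _ => stronglyMeasurable_const)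
    (Eventually.of_forall fun _ _ => ⟨continuousWithinAt_const, 0, tendsto_const_nhds⟩)
    (Eventually.of_forall fun _ s _ _ => by
      have : valueBefore (fun _ : ℝ≥0 => (0 : StateSpace μ)) s = 0 := by
        unfold valueBefore
        split_ifs with h
        · rfl
        · have : (𝓝[<] s).NeBot := nhdsLT_neBot_of_exists_lt ⟨0, pos_iff_ne_zero.mpr h⟩
          exact leftLim_eq_of_tendsto tendsto_const_nhds
      rw [this, sub_zero]
      exact Δ.zero_mem)
    (Eventually.of_forall fun _ _ => le_rfl)
    (Eventually.of_forall fun _ _ => integrableOn_zero)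
    (Eventually.of_forall fun _ _ => by simp)
    (fun _ => by simp) (fun _ => by simp)

theorem IsCadlag.smul_add_smul {H : Type*} [NormedAddCommGroup H] [NormedSpace ℝ H]
    {γ γ' : ℝ≥0 → H} (h : IsCadlag γ) (h' : IsCadlag γ') (a b : ℝ≥0) :
    IsCadlag fun t => a • γ t + b • γ' t := fun t => by
  obtain ⟨h1, l, hl⟩ := h t
  obtain ⟨h1', l', hl'⟩ := h' t
  exact ⟨(h1.const_smul a).add (h1'.const_smul b), _, (hl.const_smul a).add (hl'.const_smul b)⟩

theorem valueBefore_smul_add_smul {H : Type*} [NormedAddCommGroup H] [NormedSpace ℝ H]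
    {γ γ' : ℝ≥0 → H} (h : IsCadlag γ) (h' : IsCadlag γ') (a b : ℝ≥0) (s : ℝ≥0) :
    valueBefore (fun t => a • γ t + b • γ' t) s
      = a • valueBefore γ s + b • valueBefore γ' s := by
  unfold valueBefore
  split_ifs with hs
  · simp
  · have : (𝓝[<] s).NeBot := nhdsLT_neBot_of_exists_lt ⟨0, pos_iff_ne_zero.mpr hs⟩
    obtain ⟨-, l, hl⟩ := h s
    obtain ⟨-, l', hl'⟩ := h' s
    rw [leftLim_eq_of_tendsto hl, leftLim_eq_of_tendsto hl']
    exact leftLim_eq_of_tendsto ((hl.const_smul a).add (hl'.const_smul b))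

theorem ennreal_add_sq_le (x y : ℝ≥0∞) : (x + y) ^ 2 ≤ 4 * x ^ 2 + 4 * y ^ 2 := by
  have h4 : ∀ z : ℝ≥0∞, (z + z) ^ 2 = 4 * z ^ 2 := fun z => by ring
  rcases le_total x y with h | h
  · calc (x + y) ^ 2 ≤ (y + y) ^ 2 := by gcongr
      _ = 4 * y ^ 2 := h4 y
      _ ≤ _ := le_add_self
  · calc (x + y) ^ 2 ≤ (x + x) ^ 2 := by gcongr
      _ = 4 * x ^ 2 := h4 x
      _ ≤ _ := le_self_add

theorem lintegral_lt_top_of_le_combination {f f₁ f₂ : Ω → ℝ≥0∞} {c d : ℝ≥0∞} (hc : c ≠ ∞)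
    (hd : d ≠ ∞) (hle : ∀ᵐ ω ∂P, f ω ≤ c * f₁ ω + d * f₂ ω) (hf₁ : AEMeasurable f₁ P)
    (h₁ : ∫⁻ ω, f₁ ω ∂P < ∞) (h₂ : ∫⁻ ω, f₂ ω ∂P < ∞) : ∫⁻ ω, f ω ∂P < ∞ := by
  refine (lintegral_mono_ae hle).trans_lt ?_
  rw [lintegral_add_left' (hf₁.const_mul _), lintegral_const_mul' _ _ hc,
    lintegral_const_mul' _ _ hd]
  finiteness

theorem measurable_setLIntegral_kernel (m : Kernel Ω ℝ≥0) [IsFiniteKernel m] (T : ℝ≥0)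
    {f : ℝ≥0 × Ω → ℝ≥0∞} (hf : Measurable f) :
    Measurable fun ω => ∫⁻ s in Icc 0 T, f (s, ω) ∂(m ω) :=
  Measurable.setLIntegral_kernel_prod_right (f := fun ω s => f (s, ω))
    (hf.comp measurable_swap) measurableSet_Icc

theorem measurable_sq_norm_div_inner {α : Type*} [MeasurableSpace α] (q : StateSpace μ)
    {θ : α → StateSpace μ} (hθ : StronglyMeasurable θ) :
    Measurable fun z => ENNReal.ofReal (‖θ z‖ ^ 2 / inner ℝ q (θ z)) :=
  ((hθ.norm.measurable.pow_const 2).div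
    (stronglyMeasurable_const.inner hθ).measurable).ennreal_ofReal

theorem AdmissibleControl.HasVarDensity.moment_sq_combination {I J : AdmissibleControl P 𝓕 Δ q}
    {m : Kernel Ω ℝ≥0} [IsFiniteKernel m] {w w' : Ω → ℝ≥0 → ℝ≥0} (hI : I.HasVarDensity m w)
    (hJ : J.HasVarDensity m w') (a b : ℝ≥0) (T : ℝ≥0) :
    ∫⁻ ω, (∫⁻ s in Icc 0 T, ‖a • I.scaledDir w s ω + b • J.scaledDir w' s ω‖ₑ ∂(m ω)) ^ 2 ∂P
      < ∞ := by
  have hηI := hI.stronglyMeasurable_scaledDir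
  have hηJ := hJ.stronglyMeasurable_scaledDir
  have hI1 := hI.setLIntegral_eq (ψ := fun _ v => ‖v‖ₑ) (fun _ => enorm_nnreal_smul)
    I.dir_measurable.enorm
  have hJ1 := hJ.setLIntegral_eq (ψ := fun _ v => ‖v‖ₑ) (fun _ => enorm_nnreal_smul)
    J.dir_measurable.enorm
  refine lintegral_lt_top_of_le_combination (c := 4 * a ^ 2) (d := 4 * b ^ 2) (by finiteness)
    (by finiteness) ?_ ?_ (I.moment_sq T) (J.moment_sq T)
  · filter_upwards [hI1, hJ1] with ω h1 h2
    rw [h1 _ measurableSet_Icc, h2 _ measurableSet_Icc]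
    have hmI := (stronglyMeasurable_section hηI ω).enorm
    have hmJ := (stronglyMeasurable_section hηJ ω).enorm
    calc (∫⁻ s in Icc 0 T, ‖a • I.scaledDir w s ω + b • J.scaledDir w' s ω‖ₑ ∂(m ω)) ^ 2
        ≤ (a * (∫⁻ s in Icc 0 T, ‖I.scaledDir w s ω‖ₑ ∂(m ω))
          + b * ∫⁻ s in Icc 0 T, ‖J.scaledDir w' s ω‖ₑ ∂(m ω)) ^ 2 := by
          gcongr
          rw [← lintegral_const_mul _ hmI, ← lintegral_const_mul _ hmJ,
            ← lintegral_add_left (hmI.const_mul _)]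
          refine lintegral_mono fun s => ?_
          rw [← enorm_nnreal_smul, ← enorm_nnreal_smul]
          exact enorm_add_le _ _
      _ ≤ _ := (ennreal_add_sq_le _ _).trans (le_of_eq (by ring))
  · refine ⟨_, (measurable_setLIntegral_kernel m T hηI.enorm).pow_const 2, ?_⟩
    filter_upwards [hI1] with ω h1
    rw [h1 _ measurableSet_Icc]
    rfl

theorem AdmissibleControl.HasVarDensity.moment_ratio_combination [IsFiniteMeasure μ] {q₀ : ℝ}
    (hq₀ : 0 < q₀) (hq : ∀ᵐ ξ ∂μ, q₀ ≤ q ξ) {I J : AdmissibleControl P 𝓕 Δ q}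
    {m : Kernel Ω ℝ≥0} [IsFiniteKernel m] {w w' : Ω → ℝ≥0 → ℝ≥0} (hI : I.HasVarDensity m w)
    (hJ : J.HasVarDensity m w') (a b : ℝ≥0) (T : ℝ≥0) :
    ∫⁻ ω, ∫⁻ s in Icc 0 T, ENNReal.ofReal (‖a • I.scaledDir w s ω + b • J.scaledDir w' s ω‖ ^ 2
      / inner ℝ q (a • I.scaledDir w s ω + b • J.scaledDir w' s ω)) ∂(m ω) ∂P < ∞ := by
  have hmI' := measurable_sq_norm_div_inner q hI.stronglyMeasurable_scaledDir
  have hI2 := hI.setLIntegral_eq (ψ := fun _ v => ENNReal.ofReal (‖v‖ ^ 2 / inner ℝ q v))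
    (fun _ => ofReal_sq_norm_div_inner_smul q) (measurable_sq_norm_div_inner q I.dir_measurable)
  have hJ2 := hJ.setLIntegral_eq (ψ := fun _ v => ENNReal.ofReal (‖v‖ ^ 2 / inner ℝ q v))
    (fun _ => ofReal_sq_norm_div_inner_smul q) (measurable_sq_norm_div_inner q J.dir_measurable)
  refine lintegral_lt_top_of_le_combination (c := a) (d := b) (by finiteness)
    (by finiteness) ?_ ?_ (I.moment_ratio T) (J.moment_ratio T)
  · filter_upwards [hI2, hJ2, I.scaledDir_nonneg w, J.scaledDir_nonneg w'] with ω h1 h2 h3 h4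
    rw [h1 _ measurableSet_Icc, h2 _ measurableSet_Icc]
    have hmI : Measurable fun s => ENNReal.ofReal
        (‖I.scaledDir w s ω‖ ^ 2 / inner ℝ q (I.scaledDir w s ω)) :=
      measurable_sq_norm_div_inner q (stronglyMeasurable_section hI.stronglyMeasurable_scaledDir ω)
    have hmJ : Measurable fun s => ENNReal.ofReal
        (‖J.scaledDir w' s ω‖ ^ 2 / inner ℝ q (J.scaledDir w' s ω)) :=
      measurable_sq_norm_div_inner q (stronglyMeasurable_section hJ.stronglyMeasurable_scaledDir ω)
    rw [← lintegral_const_mul _ hmI, ← lintegral_const_mul _ hmJ,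
      ← lintegral_add_left (hmI.const_mul _)]
    exact lintegral_mono fun s => sq_norm_div_inner_add_le hq₀ hq a b (h3 s) (h4 s)
  · refine ⟨_, measurable_setLIntegral_kernel m T hmI', ?_⟩
    filter_upwards [hI2] with ω h1
    rw [h1 _ measurableSet_Icc]
    rfl

/-- Nonnegative linear combinations of admissible controls are admissible, and the measures `dI`
combine linearly. Both controls have densities with respect to one kernel `m`, and the combination
is polarized again. -/
theorem AdmissibleControl.exists_combination [IsFiniteMeasure μ] {q₀ : ℝ} (hq₀ : 0 < q₀)
    (hq : ∀ᵐ ξ ∂μ, q₀ ≤ q ξ) (I J : AdmissibleControl P 𝓕 Δ q) (a b : ℝ≥0) :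
    ∃ (m : Kernel Ω ℝ≥0) (w w' w'' : Ω → ℝ≥0 → ℝ≥0) (L : AdmissibleControl P 𝓕 Δ q),
      IsFiniteKernel m ∧ I.HasVarDensity m w ∧ J.HasVarDensity m w' ∧ L.HasVarDensity m w'' ∧
      L.scaledDir w'' = fun s ω => a • I.scaledDir w s ω + b • J.scaledDir w' s ω := by
  obtain ⟨m, w, w', hm, hI, hJ⟩ := I.exists_hasVarDensity J
  set η : ℝ≥0 → Ω → StateSpace μ := fun s ω => a • I.scaledDir w s ω + b • J.scaledDir w' s ω
    with hη_def
  have hηI := hI.stronglyMeasurable_scaledDir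
  have hηJ := hJ.stronglyMeasurable_scaledDir
  have hη : StronglyMeasurable (Function.uncurry η) := (hηI.const_smul a).add (hηJ.const_smul b)
  let L : AdmissibleControl P 𝓕 Δ q := AdmissibleControl.ofDensity m η
    (fun t ω => a • I.toFun t ω + b • J.toFun t ω) hη
    (fun t => ((I.adapted t).const_smul a).add ((J.adapted t).const_smul b))
    (by
      filter_upwards [I.cadlag, J.cadlag] with ω h h'
      exact h.smul_add_smul h' a b)
    (by
      filter_upwards [I.cadlag, J.cadlag, I.increment_mem, J.increment_mem]
        with ω h h' h1 h2 s t hst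
      rw [valueBefore_smul_add_smul h h', add_sub_add_comm, ← smul_sub, ← smul_sub]
      exact Δ.add_mem (Δ.smul_mem a.coe_nonneg (h1 s t hst)) (Δ.smul_mem b.coe_nonneg (h2 s t hst)))
    (by
      filter_upwards [I.scaledDir_nonneg w, J.scaledDir_nonneg w'] with ω h1 h2 t
      exact add_nonneg (nnreal_smul_nonneg a (h1 t)) (nnreal_smul_nonneg b (h2 t)))
    (by
      filter_upwards [hI.integrableOn_scaledDir, hJ.integrableOn_scaledDir] with ω h1 h2 t
      exact ((h1 t).smul (a : ℝ)).add ((h2 t).smul (b : ℝ)))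
    (by
      filter_upwards [hI.integrableOn_scaledDir, hJ.integrableOn_scaledDir, hI.toFun_eq,
        hJ.toFun_eq] with ω h1 h2 h3 h4 t
      simp only [hη_def, NNReal.smul_def]
      have i1 : IntegrableOn (fun s => (a : ℝ) • I.scaledDir w s ω) (Icc 0 t) (m ω) :=
        (h1 t).smul (a : ℝ)
      have i2 : IntegrableOn (fun s => (b : ℝ) • J.scaledDir w' s ω) (Icc 0 t) (m ω) :=
        (h2 t).smul (b : ℝ)
      rw [integral_add i1 i2, integral_smul, integral_smul, h3, h4])
    (hI.moment_sq_combination hJ a b) (hI.moment_ratio_combination hq₀ hq hJ a b)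
  refine ⟨m, w, w', fun ω s => ‖η s ω‖₊, L, hm, hI, hJ,
    AdmissibleControl.hasVarDensity_ofDensity m hη rfl, ?_⟩
  funext s ω
  exact nnnorm_smul_inv_nnnorm_smul (η s ω)

end Combination

/-! ### Discounting and the state process -/

section Discount

variable {Ω : Type*} [mΩ : MeasurableSpace Ω]

theorem lintegral_exp_neg_mul {r : ℝ} (hr : 0 < r) :
    ∫⁻ t in Ici (0 : ℝ), ENNReal.ofReal (Real.exp (-r * t)) = ENNReal.ofReal (1 / r) := by
  rw [← ofReal_integral_eq_lintegral_ofReal]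
  · rw [integral_Ici_eq_integral_Ioi, integral_exp_mul_Ioi (by linarith) 0]
    congr 1
    simp [neg_div_neg_eq]
  · exact (integrableOn_exp_mul_Ioi (by linarith) 0).congr_set_ae Ioi_ae_eq_Ici.symm
  · exact Eventually.of_forall fun t => (Real.exp_pos _).le

/-- The discount measure `e^{-ρt} dt` on `[0, ∞)`. -/
noncomputable def discountMeasure (ρ : ℝ) : Measure ℝ :=
  (volume.restrict (Ici (0 : ℝ))).withDensity fun t => ENNReal.ofReal (Real.exp (-ρ * t))

theorem discountMeasure_univ {ρ : ℝ} (hρ : 0 < ρ) :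
    discountMeasure ρ univ = ENNReal.ofReal (1 / ρ) := by
  rw [discountMeasure, withDensity_apply _ MeasurableSet.univ, Measure.restrict_univ,
    lintegral_exp_neg_mul hρ]

theorem isFiniteMeasure_discountMeasure {ρ : ℝ} (hρ : 0 < ρ) :
    IsFiniteMeasure (discountMeasure ρ) :=
  ⟨by rw [discountMeasure_univ hρ]; exact ENNReal.ofReal_lt_top⟩

theorem prod_discountMeasure_univ (P : Measure Ω) [IsProbabilityMeasure P] {ρ : ℝ} (hρ : 0 < ρ) :
    (P.prod (discountMeasure ρ)) univ = ENNReal.ofReal (1 / ρ) := by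
  have := isFiniteMeasure_discountMeasure hρ
  rw [← univ_prod_univ, Measure.prod_prod, measure_univ, one_mul, discountMeasure_univ hρ]

theorem lintegral_discountMeasure (ρ : ℝ) (f : ℝ → ℝ≥0∞) : ∫⁻ t, f t ∂(discountMeasure ρ)
    = ∫⁻ t in Ici (0 : ℝ), ENNReal.ofReal (Real.exp (-ρ * t)) * f t := by
  rw [discountMeasure, lintegral_withDensity_eq_lintegral_mul_non_measurable]
  · rfl
  · fun_prop
  · exact Eventually.of_forall fun _ => ENNReal.ofReal_lt_top

/-- `∫₀^∞ t e^{-ρt} dt < ∞`, by `ρt/2 ≤ e^{ρt/2}`. -/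
theorem lintegral_toNNReal_discountMeasure_lt_top {ρ : ℝ} (hρ : 0 < ρ) :
    ∫⁻ t, (t.toNNReal : ℝ≥0∞) ∂(discountMeasure ρ) < ∞ := by
  rw [lintegral_discountMeasure]
  calc ∫⁻ t in Ici (0 : ℝ), ENNReal.ofReal (Real.exp (-ρ * t)) * (t.toNNReal : ℝ≥0∞)
      ≤ ∫⁻ t in Ici (0 : ℝ),
          ENNReal.ofReal (2 / ρ) * ENNReal.ofReal (Real.exp (-(ρ / 2) * t)) := by
        refine setLIntegral_mono' measurableSet_Ici fun t (ht : 0 ≤ t) => ?_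
        change _ * ENNReal.ofReal t ≤ _
        rw [← ENNReal.ofReal_mul (Real.exp_pos _).le, ← ENNReal.ofReal_mul (by positivity)]
        refine ENNReal.ofReal_le_ofReal ?_
        have h1 : ρ / 2 * t ≤ Real.exp (ρ / 2 * t) := by
          linarith [Real.add_one_le_exp (ρ / 2 * t)]
        have h2 : Real.exp (-(ρ / 2) * t) = Real.exp (-ρ * t) * Real.exp (ρ / 2 * t) := by
          rw [← Real.exp_add]; ring_nf
        rw [h2]
        calc Real.exp (-ρ * t) * t = 2 / ρ * (Real.exp (-ρ * t) * (ρ / 2 * t)) := by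
              field_simp
          _ ≤ _ := by gcongr
    _ = ENNReal.ofReal (2 / ρ) * ENNReal.ofReal (1 / (ρ / 2)) := by
        rw [lintegral_const_mul' _ _ ENNReal.ofReal_ne_top, lintegral_exp_neg_mul (by positivity)]
    _ < ∞ := ENNReal.mul_lt_top ENNReal.ofReal_lt_top ENNReal.ofReal_lt_top

end Discount

section State

variable {D : Type*} [MeasurableSpace D] {Ω : Type*} [mΩ : MeasurableSpace Ω]
  {μ : Measure D} {P : Measure Ω} {𝓕 : Filtration ℝ≥0 mΩ}
  {Δ : PointedCone ℝ (StateSpace μ)} {q : StateSpace μ}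
  {S : ℝ≥0 → StateSpace μ →L[ℝ] StateSpace μ} {Z : ℝ≥0 → Ω → StateSpace μ}

/-- The variation measure of a control is not known to be an s-finite kernel, so joint
measurability of the state is only clear for a version that integrates against a finite kernel. -/
theorem AdmissibleControl.exists_stronglyMeasurable_state
    (hSc : Continuous fun z : ℝ≥0 × StateSpace μ => S z.1 z.2)
    (hZ : StronglyMeasurable (Function.uncurry Z)) (x : StateSpace μ)
    (I : AdmissibleControl P 𝓕 Δ q) :
    ∃ Y : ℝ≥0 → Ω → StateSpace μ, StronglyMeasurable (Function.uncurry Y) ∧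
      ∀ᵐ ω ∂P, ∀ t, state S Z x I t ω = Y t ω := by
  obtain ⟨m, w, -, hm, hw, -⟩ := I.exists_hasVarDensity I
  let f : (ℝ≥0 × Ω) × ℝ≥0 → StateSpace μ := {z | z.2 ≤ z.1.1}.indicator
    fun z => S (z.1.1 - z.2) (I.scaledDir w z.2 z.1.2)
  have hf : StronglyMeasurable f := by
    refine StronglyMeasurable.indicator ?_ (measurableSet_le measurable_snd measurable_fst.fst)
    have h1 : StronglyMeasurable fun z : (ℝ≥0 × Ω) × ℝ≥0 => I.scaledDir w z.2 z.1.2 :=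
      hw.stronglyMeasurable_scaledDir.comp_measurable
        (measurable_snd.prodMk measurable_fst.snd)
    have h2 : StronglyMeasurable fun z : (ℝ≥0 × Ω) × ℝ≥0 => z.1.1 - z.2 :=
      (measurable_fst.fst.sub measurable_snd).stronglyMeasurable
    exact hSc.comp_stronglyMeasurable (h2.prodMk h1)
  have hint : StronglyMeasurable fun z : ℝ≥0 × Ω => ∫ s, f (z, s) ∂(m z.2) :=
    hf.integral_kernel_prod_right' (κ := Kernel.prodMkLeft ℝ≥0 m)
  refine ⟨fun t ω => S t x + Z t ω + ∫ s, f ((t, ω), s) ∂(m ω), ?_, ?_⟩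
  · have h3 : StronglyMeasurable fun z : ℝ≥0 × Ω => S z.1 x :=
      hSc.comp_stronglyMeasurable (measurable_fst.stronglyMeasurable.prodMk
        stronglyMeasurable_const)
    exact (h3.add hZ).add hint
  · filter_upwards [hw.setIntegral_eq] with ω h t
    rw [state, h t fun s => S (t - s), ← integral_indicator measurableSet_Icc]
    congr 2
    funext s
    by_cases hs : s ≤ t
    · simp [f, hs]
    · simp [f, hs]

theorem AdmissibleControl.aestronglyMeasurable_state [IsProbabilityMeasure P]
    (hSc : Continuous fun z : ℝ≥0 × StateSpace μ => S z.1 z.2)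
    (hZ : StronglyMeasurable (Function.uncurry Z)) (x : StateSpace μ)
    (I : AdmissibleControl P 𝓕 Δ q) (ν : Measure ℝ) [SFinite ν] :
    AEStronglyMeasurable (fun z : Ω × ℝ => state S Z x I z.2.toNNReal z.1) (P.prod ν) := by
  obtain ⟨Y, hY, h⟩ := I.exists_stronglyMeasurable_state hSc hZ x
  refine ⟨fun z => Y z.2.toNNReal z.1,
    hY.comp_measurable (measurable_snd.real_toNNReal.prodMk measurable_fst), ?_⟩
  filter_upwards [Measure.quasiMeasurePreserving_fst.ae h] with z hz
  exact hz _

/-- The running cost as one integral over `Ω × [0, ∞)`; this requires the joint measurability of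
the state. -/
theorem runningCost_eq_lintegral_prod [IsProbabilityMeasure P] {ρ : ℝ} (hρ : 0 < ρ)
    (hSc : Continuous fun z : ℝ≥0 × StateSpace μ => S z.1 z.2)
    (hZ : StronglyMeasurable (Function.uncurry Z)) (x : StateSpace μ)
    (I : AdmissibleControl P 𝓕 Δ q) {g : StateSpace μ → ℝ} (hg : Continuous g) :
    runningCost ρ S Z x I g = ∫⁻ z : Ω × ℝ, ENNReal.ofReal (g (state S Z x I z.2.toNNReal z.1))
      ∂(P.prod (discountMeasure ρ)) := by
  have := isFiniteMeasure_discountMeasure hρ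
  rw [lintegral_prod _ (hg.comp_aestronglyMeasurable
    (I.aestronglyMeasurable_state hSc hZ x (discountMeasure ρ))).aemeasurable.ennreal_ofReal]
  simp only [runningCost, lintegral_discountMeasure, ENNReal.ofReal_mul (Real.exp_pos _).le]

theorem integrableOn_semigroup_apply (hSc : Continuous fun z : ℝ≥0 × StateSpace μ => S z.1 z.2)
    (hSn : ∀ t x, ‖S t x‖ ≤ ‖x‖) {m : Measure ℝ≥0} {η : ℝ≥0 → StateSpace μ} {t : ℝ≥0}
    (hη : IntegrableOn η (Icc 0 t) m) :
    IntegrableOn (fun s => S (t - s) (η s)) (Icc 0 t) m := by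
  refine Integrable.mono hη ?_ (Eventually.of_forall fun s => hSn _ _)
  have h : Measurable fun s : ℝ≥0 => t - s := measurable_const.sub measurable_id
  exact hSc.comp_aestronglyMeasurable (h.aestronglyMeasurable.prodMk hη.1)

/-- The state is affine in the pair (initial condition, control); `a + b = 1` is needed for the
noise term only. -/
theorem state_combination (hSc : Continuous fun z : ℝ≥0 × StateSpace μ => S z.1 z.2)
    (hSn : ∀ t x, ‖S t x‖ ≤ ‖x‖) {I J L : AdmissibleControl P 𝓕 Δ q} {m : Kernel Ω ℝ≥0}
    {w w' w'' : Ω → ℝ≥0 → ℝ≥0} (hI : I.HasVarDensity m w) (hJ : J.HasVarDensity m w')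
    (hL : L.HasVarDensity m w'') {a b : ℝ≥0} (hab : a + b = 1)
    (hdir : L.scaledDir w'' = fun s ω => a • I.scaledDir w s ω + b • J.scaledDir w' s ω)
    (x y : StateSpace μ) : ∀ᵐ ω ∂P, ∀ t, state S Z (a • x + b • y) L t ω
      = a • state S Z x I t ω + b • state S Z y J t ω := by
  filter_upwards [hI.setIntegral_eq, hJ.setIntegral_eq, hL.setIntegral_eq,
    hI.integrableOn_scaledDir, hJ.integrableOn_scaledDir] with ω h1 h2 h3 h4 h5 t
  simp only [state]
  rw [h1 t fun s => S (t - s), h2 t fun s => S (t - s), h3 t fun s => S (t - s), hdir]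
  have i1 : IntegrableOn (fun s => (a : ℝ) • S (t - s) (I.scaledDir w s ω)) (Icc 0 t) (m ω) :=
    (integrableOn_semigroup_apply hSc hSn (h4 t)).smul (a : ℝ)
  have i2 : IntegrableOn (fun s => (b : ℝ) • S (t - s) (J.scaledDir w' s ω)) (Icc 0 t) (m ω) :=
    (integrableOn_semigroup_apply hSc hSn (h5 t)).smul (b : ℝ)
  simp only [NNReal.smul_def, map_add, map_smul]
  rw [integral_add i1 i2, integral_smul, integral_smul]
  have hZab : Z t ω = (a : ℝ) • Z t ω + (b : ℝ) • Z t ω := by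
    rw [← add_smul, ← NNReal.coe_add, hab, NNReal.coe_one, one_smul]
  nth_rewrite 1 [hZab]
  module

/-- The cost of control is linear in the control; no cancellation occurs since `dI ≥ 0`. -/
theorem controlCost_combination [IsFiniteMeasure μ] {q₀ : ℝ} (hq₀ : 0 < q₀)
    (hq : ∀ᵐ ξ ∂μ, q₀ ≤ q ξ) (ρ : ℝ) {I J L : AdmissibleControl P 𝓕 Δ q} {m : Kernel Ω ℝ≥0}
    [IsFiniteKernel m] {w w' w'' : Ω → ℝ≥0 → ℝ≥0} (hI : I.HasVarDensity m w)
    (hJ : J.HasVarDensity m w') (hL : L.HasVarDensity m w'') {a b : ℝ≥0}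
    (hdir : L.scaledDir w'' = fun s ω => a • I.scaledDir w s ω + b • J.scaledDir w' s ω) :
    controlCost ρ L = a * controlCost ρ I + b * controlCost ρ J := by
  have hmeas : ∀ {θ : ℝ≥0 → Ω → StateSpace μ}, StronglyMeasurable (Function.uncurry θ) →
      Measurable fun z : ℝ≥0 × Ω =>
        ENNReal.ofReal (Real.exp (-ρ * z.1) * inner ℝ q (θ z.1 z.2)) := fun {θ} hθ => by
    have h : StronglyMeasurable fun z : ℝ≥0 × Ω => θ z.1 z.2 := hθ
    have h1 : Measurable fun z : ℝ≥0 × Ω => inner ℝ q (θ z.1 z.2) :=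
      (stronglyMeasurable_const.inner h).measurable
    have h2 : Measurable fun z : ℝ≥0 × Ω => Real.exp (-ρ * z.1) := by fun_prop
    exact (h2.mul h1).ennreal_ofReal
  have hcost : ∀ {I : AdmissibleControl P 𝓕 Δ q} {w : Ω → ℝ≥0 → ℝ≥0}, I.HasVarDensity m w →
      controlCost ρ I = ∫⁻ ω, ∫⁻ s, ENNReal.ofReal (Real.exp (-ρ * s)
        * inner ℝ q (I.scaledDir w s ω)) ∂(m ω) ∂P := by
    intro I w hI
    refine lintegral_congr_ae ?_
    filter_upwards [hI.setLIntegral_eq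
      (ψ := fun s v => ENNReal.ofReal (Real.exp (-ρ * s) * inner ℝ q v))
      (fun s => ofReal_mul_inner_smul q _) (hmeas I.dir_measurable)] with ω h
    simpa only [Measure.restrict_univ] using h univ MeasurableSet.univ
  have hcm : ∀ {I : AdmissibleControl P 𝓕 Δ q} {w : Ω → ℝ≥0 → ℝ≥0}, I.HasVarDensity m w →
      Measurable fun ω => ∫⁻ s : ℝ≥0, ENNReal.ofReal (Real.exp (-ρ * s)
        * inner ℝ q (I.scaledDir w s ω)) ∂(m ω) := fun {I w} hI =>
    Measurable.lintegral_kernel_prod_right (f := fun ω (s : ℝ≥0) => ENNReal.ofReal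
      (Real.exp (-ρ * s) * inner ℝ q (I.scaledDir w s ω)))
      ((hmeas hI.stronglyMeasurable_scaledDir).comp measurable_swap)
  rw [hcost hI, hcost hJ, hcost hL, ← lintegral_const_mul _ (hcm hI),
    ← lintegral_const_mul _ (hcm hJ), ← lintegral_add_left ((hcm hI).const_mul _)]
  refine lintegral_congr_ae ?_
  filter_upwards [I.scaledDir_nonneg w, J.scaledDir_nonneg w'] with ω h1 h2
  have hmI : Measurable fun s : ℝ≥0 => ENNReal.ofReal (Real.exp (-ρ * s)
      * inner ℝ q (I.scaledDir w s ω)) :=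
    (hmeas hI.stronglyMeasurable_scaledDir).comp (measurable_prodMk_right (y := ω))
  have hmJ : Measurable fun s : ℝ≥0 => ENNReal.ofReal (Real.exp (-ρ * s)
      * inner ℝ q (J.scaledDir w' s ω)) :=
    (hmeas hJ.stronglyMeasurable_scaledDir).comp (measurable_prodMk_right (y := ω))
  rw [← lintegral_const_mul _ hmI, ← lintegral_const_mul _ hmJ,
    ← lintegral_add_left (hmI.const_mul _)]
  refine lintegral_congr fun s => ?_
  have n1 := inner_nonneg_of_nonneg hq₀ hq (nnreal_smul_nonneg a (h1 s))
  have n2 := inner_nonneg_of_nonneg hq₀ hq (nnreal_smul_nonneg b (h2 s))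
  rw [← ofReal_mul_inner_smul, ← ofReal_mul_inner_smul, hdir, inner_add_right, mul_add,
    ENNReal.ofReal_add (by positivity) (by positivity)]

end State

/-! ### The cost functional and its infimum -/

section ShiftedCost

variable {D : Type*} [MeasurableSpace D] {Ω : Type*} [mΩ : MeasurableSpace Ω]
  {μ : Measure D} {P : Measure Ω} {𝓕 : Filtration ℝ≥0 mΩ}
  {Δ : PointedCone ℝ (StateSpace μ)} {q : StateSpace μ}
  {S : ℝ≥0 → StateSpace μ →L[ℝ] StateSpace μ} {Z : ℝ≥0 → Ω → StateSpace μ}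
  {G : StateSpace μ → ℝ} {ρ κ : ℝ}

/-- The cost with `G` replaced by `G + κ`. It lies in `[0, ∞]` when `G ≥ -κ` and exceeds the cost
by the constant `κ / ρ`. -/
noncomputable def shiftedCost (ρ : ℝ) (S : ℝ≥0 → StateSpace μ →L[ℝ] StateSpace μ)
    (Z : ℝ≥0 → Ω → StateSpace μ) (G : StateSpace μ → ℝ) (κ : ℝ) (x : StateSpace μ)
    (I : AdmissibleControl P 𝓕 Δ q) : ℝ≥0∞ :=
  runningCost ρ S Z x I (fun y => G y + κ) + controlCost ρ I

theorem coe_ennreal_add_sub_coe_eq {R R' C N k : ℝ≥0∞} (h : R + k = R' + N) (hN : N ≠ ∞)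
    (hk : k ≠ ∞) : ((R + C : ℝ≥0∞) : EReal) - (N : EReal) = ((R' + C : ℝ≥0∞) : EReal) - k := by
  lift N to ℝ≥0 using hN
  lift k to ℝ≥0 using hk
  rcases eq_or_ne C ∞ with rfl | hC
  · simp only [add_top, EReal.coe_ennreal_top]
    rfl
  lift C to ℝ≥0 using hC
  rcases eq_or_ne R ∞ with rfl | hR
  · have : R' = ∞ := by
      by_contra hR'
      lift R' to ℝ≥0 using hR'
      rw [top_add] at h
      exact ENNReal.coe_ne_top (r := R' + N) (by push_cast; exact h.symm)
    rw [this, top_add, EReal.coe_ennreal_top]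
    rfl
  lift R to ℝ≥0 using hR
  have hR' : R' ≠ ∞ := by
    rintro rfl
    rw [top_add] at h
    exact ENNReal.coe_ne_top (r := R + k) (by push_cast; exact h)
  lift R' to ℝ≥0 using hR'
  have h' : (R : ℝ) + k = R' + N := by exact_mod_cast h
  have e : (R : ℝ) + C - N = R' + C - k := by linarith
  rw [← ENNReal.coe_add, ← ENNReal.coe_add]
  simp only [EReal.coe_nnreal_eq_coe_real]
  rw [← EReal.coe_sub, ← EReal.coe_sub, NNReal.coe_add, NNReal.coe_add, e]

theorem cost_eq_shiftedCost_sub [IsProbabilityMeasure P] (hρ : 0 < ρ)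
    (hSc : Continuous fun z : ℝ≥0 × StateSpace μ => S z.1 z.2)
    (hZ : StronglyMeasurable (Function.uncurry Z)) (hG : Continuous G) (hκ : ∀ x, -κ ≤ G x)
    (hκ0 : 0 ≤ κ) (x : StateSpace μ) (I : AdmissibleControl P 𝓕 Δ q) :
    cost ρ S Z G x I = (shiftedCost ρ S Z G κ x I : EReal) - ((κ / ρ : ℝ) : EReal) := by
  have := isFiniteMeasure_discountMeasure hρ
  have hQ := prod_discountMeasure_univ P hρ
  have hneg : Continuous fun y => max (-G y) 0 := by fun_prop
  have hpos : Continuous fun y => max (G y) 0 := by fun_prop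
  have hshift : Continuous fun y => G y + κ := by fun_prop
  have hk : ∫⁻ _ : Ω × ℝ, ENNReal.ofReal κ ∂(P.prod (discountMeasure ρ))
      = ENNReal.ofReal (κ / ρ) := by
    rw [lintegral_const, hQ, ← ENNReal.ofReal_mul hκ0, mul_one_div]
  have h1 : runningCost ρ S Z x I (fun y => max (G y) 0) + ENNReal.ofReal (κ / ρ)
      = runningCost ρ S Z x I (fun y => G y + κ)
        + runningCost ρ S Z x I (fun y => max (-G y) 0) := by
    rw [runningCost_eq_lintegral_prod hρ hSc hZ x I hpos,
      runningCost_eq_lintegral_prod hρ hSc hZ x I hneg,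
      runningCost_eq_lintegral_prod hρ hSc hZ x I hshift, ← hk,
      ← lintegral_add_right _ measurable_const, ← lintegral_add_right' _
        (hneg.comp_aestronglyMeasurable (I.aestronglyMeasurable_state hSc hZ x
          (discountMeasure ρ))).aemeasurable.ennreal_ofReal]
    refine lintegral_congr fun z => ?_
    set y := state S Z x I z.2.toNNReal z.1
    have := hκ y
    rw [← ENNReal.ofReal_add (le_max_right _ _) hκ0,
      ← ENNReal.ofReal_add (by linarith) (le_max_right _ _)]
    congr 1
    rcases le_total (G y) 0 with h | h
    · rw [max_eq_right h, max_eq_left (by linarith)]; ring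
    · rw [max_eq_left h, max_eq_right (by linarith)]; ring
  have h2 : runningCost ρ S Z x I (fun y => max (-G y) 0) ≠ ∞ := by
    refine ne_top_of_le_ne_top (ENNReal.ofReal_ne_top (r := κ / ρ)) ?_
    rw [runningCost_eq_lintegral_prod hρ hSc hZ x I hneg, ← hk]
    refine lintegral_mono fun z => ENNReal.ofReal_le_ofReal (max_le ?_ hκ0)
    linarith [hκ (state S Z x I z.2.toNNReal z.1)]
  rw [cost, coe_ennreal_add_sub_coe_eq h1 h2 ENNReal.ofReal_ne_top, shiftedCost,
    EReal.coe_ennreal_ofReal, max_eq_left (by positivity)]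

/-- A convex combination of two controls costs at most the convex combination of their costs. -/
theorem exists_shiftedCost_combination_le [IsFiniteMeasure μ] [IsProbabilityMeasure P]
    (hρ : 0 < ρ) (hSc : Continuous fun z : ℝ≥0 × StateSpace μ => S z.1 z.2)
    (hSn : ∀ t x, ‖S t x‖ ≤ ‖x‖)
    (hZ : StronglyMeasurable (Function.uncurry Z)) (hG : Continuous G) (hGc : ConvexOn ℝ univ G)
    (hκ : ∀ x, -κ ≤ G x) {q₀ : ℝ} (hq₀ : 0 < q₀)
    (hq : ∀ᵐ ξ ∂μ, q₀ ≤ q ξ) (I J : AdmissibleControl P 𝓕 Δ q) {a b : ℝ≥0} (hab : a + b = 1)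
    (x y : StateSpace μ) : ∃ L : AdmissibleControl P 𝓕 Δ q,
      shiftedCost ρ S Z G κ (a • x + b • y) L
        ≤ a * shiftedCost ρ S Z G κ x I + b * shiftedCost ρ S Z G κ y J := by
  have := isFiniteMeasure_discountMeasure hρ
  obtain ⟨m, w, w', w'', L, hm, hI, hJ, hL, hdir⟩ := I.exists_combination hq₀ hq J a b
  refine ⟨L, ?_⟩
  have hshift : Continuous fun y => G y + κ := by fun_prop
  have hmeas := fun x (I : AdmissibleControl P 𝓕 Δ q) => (hshift.comp_aestronglyMeasurable
    (I.aestronglyMeasurable_state hSc hZ x (discountMeasure ρ))).aemeasurable.ennreal_ofReal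
  have hrun : runningCost ρ S Z (a • x + b • y) L (fun y => G y + κ)
      ≤ a * runningCost ρ S Z x I (fun y => G y + κ)
        + b * runningCost ρ S Z y J (fun y => G y + κ) := by
    rw [runningCost_eq_lintegral_prod hρ hSc hZ _ _ hshift,
      runningCost_eq_lintegral_prod hρ hSc hZ _ _ hshift,
      runningCost_eq_lintegral_prod hρ hSc hZ _ _ hshift,
      ← lintegral_const_mul'' _ (hmeas x I), ← lintegral_const_mul'' _ (hmeas y J),
      ← lintegral_add_left' ((hmeas x I).const_mul _)]
    refine lintegral_mono_ae ?_
    filter_upwards [Measure.quasiMeasurePreserving_fst.ae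
      (state_combination hSc hSn (Z := Z) hI hJ hL hab hdir x y)] with z hz
    rw [hz]
    set u := state S Z x I z.2.toNNReal z.1
    set v := state S Z y J z.2.toNNReal z.1
    have hu := hκ u
    have hv := hκ v
    have hab' : (a : ℝ) + b = 1 := by exact_mod_cast hab
    rw [← ENNReal.ofReal_coe_nnreal (p := a), ← ENNReal.ofReal_coe_nnreal (p := b),
      ← ENNReal.ofReal_mul a.coe_nonneg, ← ENNReal.ofReal_mul b.coe_nonneg,
      ← ENNReal.ofReal_add (mul_nonneg a.coe_nonneg (by linarith))
        (mul_nonneg b.coe_nonneg (by linarith))]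
    refine ENNReal.ofReal_le_ofReal ?_
    have := hGc.2 (mem_univ u) (mem_univ v) a.coe_nonneg b.coe_nonneg hab'
    rw [NNReal.smul_def, NNReal.smul_def]
    simp only [smul_eq_mul] at this
    have e : κ = a * κ + b * κ := by rw [← add_mul, hab', one_mul]
    linarith
  rw [shiftedCost, shiftedCost, shiftedCost,
    controlCost_combination hq₀ hq ρ hI hJ hL hdir]
  calc _ ≤ _ := add_le_add_left hrun _
    _ = _ := by ring

/-- Semiconcavity of the cost in the initial condition, for a fixed control. -/
theorem shiftedCost_semiconcave [IsProbabilityMeasure P]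
    (hρ : 0 < ρ) (hSc : Continuous fun z : ℝ≥0 × StateSpace μ => S z.1 z.2)
    (hSn : ∀ t x, ‖S t x‖ ≤ ‖x‖)
    (hZ : StronglyMeasurable (Function.uncurry Z)) (hG : Continuous G) {c : ℝ} (hc : 0 ≤ c)
    (hGs : IsSemiconcave G c)
    (hκ : ∀ x, -κ ≤ G x) (I : AdmissibleControl P 𝓕 Δ q) {a b : ℝ≥0} (hab : a + b = 1)
    (x y : StateSpace μ) :
    a * shiftedCost ρ S Z G κ x I + b * shiftedCost ρ S Z G κ y I
      ≤ shiftedCost ρ S Z G κ (a • x + b • y) I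
        + ENNReal.ofReal (c / ρ / 2 * a * b * ‖x - y‖ ^ 2) := by
  have := isFiniteMeasure_discountMeasure hρ
  have hab' : (a : ℝ) + b = 1 := by exact_mod_cast hab
  have hQ := prod_discountMeasure_univ P hρ
  have hshift : Continuous fun y => G y + κ := by fun_prop
  have hmeas := fun x => (hshift.comp_aestronglyMeasurable
    (I.aestronglyMeasurable_state hSc hZ x (discountMeasure ρ))).aemeasurable.ennreal_ofReal
  have hconst : ENNReal.ofReal (c / ρ / 2 * a * b * ‖x - y‖ ^ 2)
      = ∫⁻ _ : Ω × ℝ, ENNReal.ofReal (c / 2 * a * b * ‖x - y‖ ^ 2)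
        ∂(P.prod (discountMeasure ρ)) := by
    rw [lintegral_const, hQ, ← ENNReal.ofReal_mul (by positivity)]
    congr 1; field_simp
  have hrun : a * runningCost ρ S Z x I (fun y => G y + κ)
        + b * runningCost ρ S Z y I (fun y => G y + κ)
      ≤ runningCost ρ S Z (a • x + b • y) I (fun y => G y + κ)
        + ENNReal.ofReal (c / ρ / 2 * a * b * ‖x - y‖ ^ 2) := by
    rw [runningCost_eq_lintegral_prod hρ hSc hZ _ _ hshift,
      runningCost_eq_lintegral_prod hρ hSc hZ _ _ hshift,
      runningCost_eq_lintegral_prod hρ hSc hZ _ _ hshift, hconst,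
      ← lintegral_const_mul'' _ (hmeas x), ← lintegral_const_mul'' _ (hmeas y),
      ← lintegral_add_left' ((hmeas x).const_mul _),
      ← lintegral_add_right _ measurable_const]
    refine lintegral_mono fun z => ?_
    have hz : state S Z (a • x + b • y) I z.2.toNNReal z.1
        = (a : ℝ) • state S Z x I z.2.toNNReal z.1
          + (1 - (a : ℝ)) • state S Z y I z.2.toNNReal z.1 := by
      have hb : (b : ℝ) = 1 - a := by linarith
      simp only [state, NNReal.smul_def, map_add, map_smul, hb]
      module
    have hdiff : ‖state S Z x I z.2.toNNReal z.1 - state S Z y I z.2.toNNReal z.1‖ ≤ ‖x - y‖ := by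
      have : state S Z x I z.2.toNNReal z.1 - state S Z y I z.2.toNNReal z.1
          = S z.2.toNNReal (x - y) := by
        simp only [state, map_sub]; abel
      rw [this]; exact hSn _ _
    rw [hz]
    set u := state S Z x I z.2.toNNReal z.1
    set v := state S Z y I z.2.toNNReal z.1
    have hu := hκ u
    have hv := hκ v
    have hw := hκ ((a : ℝ) • u + (1 - (a : ℝ)) • v)
    rw [← ENNReal.ofReal_coe_nnreal (p := a), ← ENNReal.ofReal_coe_nnreal (p := b),
      ← ENNReal.ofReal_mul a.coe_nonneg, ← ENNReal.ofReal_mul b.coe_nonneg,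
      ← ENNReal.ofReal_add (mul_nonneg a.coe_nonneg (by linarith))
        (mul_nonneg b.coe_nonneg (by linarith)),
      ← ENNReal.ofReal_add (by linarith) (by positivity)]
    refine ENNReal.ofReal_le_ofReal ?_
    have h1 := hGs u v a ⟨a.coe_nonneg, by linarith [b.coe_nonneg]⟩
    have hb : (b : ℝ) = 1 - a := by linarith
    have h2 : c / 2 * a * (1 - (a : ℝ)) * ‖u - v‖ ^ 2 ≤ c / 2 * a * b * ‖x - y‖ ^ 2 := by
      rw [← hb]; gcongr
    rw [hb] at h2 ⊢
    linarith
  rw [shiftedCost, shiftedCost, shiftedCost]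
  have hcc : controlCost ρ I = a * controlCost ρ I + b * controlCost ρ I := by
    rw [← add_mul, ← ENNReal.coe_add, hab, ENNReal.coe_one, one_mul]
  calc _ = (a * runningCost ρ S Z x I (fun y => G y + κ)
        + b * runningCost ρ S Z y I (fun y => G y + κ))
        + (a * controlCost ρ I + b * controlCost ρ I) := by ring
    _ ≤ (runningCost ρ S Z (a • x + b • y) I (fun y => G y + κ)
        + ENNReal.ofReal (c / ρ / 2 * a * b * ‖x - y‖ ^ 2)) + controlCost ρ I := by
        rw [← hcc]; gcongr
    _ = _ := by ring

theorem state_zero (x : StateSpace μ) (t : ℝ≥0) (ω : Ω) :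
    state S Z x (AdmissibleControl.zero : AdmissibleControl P 𝓕 Δ q) t ω = S t x + Z t ω := by
  simp [state, AdmissibleControl.zero, AdmissibleControl.ofDensity, polarDir]

theorem controlCost_zero (ρ : ℝ) :
    controlCost ρ (AdmissibleControl.zero : AdmissibleControl P 𝓕 Δ q) = 0 := by
  simp [controlCost, AdmissibleControl.zero, AdmissibleControl.ofDensity, polarDir]

/-- The uncontrolled cost grows at most quadratically. -/
theorem exists_shiftedCost_zero_le [IsProbabilityMeasure P]
    (hρ : 0 < ρ) (hSc : Continuous fun z : ℝ≥0 × StateSpace μ => S z.1 z.2)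
    (hSn : ∀ t x, ‖S t x‖ ≤ ‖x‖)
    (hZ : StronglyMeasurable (Function.uncurry Z)) (hG : Continuous G) {c₀ : ℝ} (hc₀ : 0 < c₀)
    (hGu : ∀ x, G x ≤ c₀ * (1 + ‖x‖ ^ 2)) (hκ0 : 0 ≤ κ)
    (hZ2 : ∫⁻ z : Ω × ℝ, ‖Z z.2.toNNReal z.1‖ₑ ^ 2 ∂(P.prod (discountMeasure ρ)) < ∞) :
    ∃ C : ℝ, 0 < C ∧ ∀ x, shiftedCost ρ S Z G κ x
      (AdmissibleControl.zero : AdmissibleControl P 𝓕 Δ q)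
        ≤ ENNReal.ofReal (C * (1 + ‖x‖ ^ 2)) := by
  have := isFiniteMeasure_discountMeasure hρ
  have hQ := prod_discountMeasure_univ P hρ
  set M := (∫⁻ z : Ω × ℝ, ‖Z z.2.toNNReal z.1‖ₑ ^ 2 ∂(P.prod (discountMeasure ρ))).toReal with hM
  have hMe : ∫⁻ z : Ω × ℝ, ‖Z z.2.toNNReal z.1‖ₑ ^ 2 ∂(P.prod (discountMeasure ρ))
      = ENNReal.ofReal M := (ENNReal.ofReal_toReal hZ2.ne).symm
  have hM0 : 0 ≤ M := ENNReal.toReal_nonneg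
  refine ⟨(c₀ + κ + 2 * c₀) / ρ + 2 * c₀ * M, by positivity, fun x => ?_⟩
  have hshift : Continuous fun y => G y + κ := by fun_prop
  rw [shiftedCost, controlCost_zero, add_zero,
    runningCost_eq_lintegral_prod hρ hSc hZ _ _ hshift]
  calc ∫⁻ z : Ω × ℝ, ENNReal.ofReal (G (state S Z x
          (AdmissibleControl.zero : AdmissibleControl P 𝓕 Δ q) z.2.toNNReal z.1) + κ)
        ∂(P.prod (discountMeasure ρ))
      ≤ ∫⁻ z : Ω × ℝ, (ENNReal.ofReal (c₀ + κ + 2 * c₀ * ‖x‖ ^ 2)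
        + ENNReal.ofReal (2 * c₀) * ‖Z z.2.toNNReal z.1‖ₑ ^ 2) ∂(P.prod (discountMeasure ρ)) := by
        refine lintegral_mono fun z => ?_
        rw [state_zero, enorm_sq_eq_ofReal, ← ENNReal.ofReal_mul (by positivity),
          ← ENNReal.ofReal_add (by positivity) (by positivity)]
        refine ENNReal.ofReal_le_ofReal ?_
        have h1 := hGu (S z.2.toNNReal x + Z z.2.toNNReal z.1)
        have h2 := (norm_add_le (S z.2.toNNReal x) (Z z.2.toNNReal z.1)).trans
          (add_le_add_left (hSn z.2.toNNReal x) _)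
        have h3 : ‖S z.2.toNNReal x + Z z.2.toNNReal z.1‖ ^ 2
            ≤ 2 * ‖x‖ ^ 2 + 2 * ‖Z z.2.toNNReal z.1‖ ^ 2 := by
          refine (pow_le_pow_left₀ (norm_nonneg _) h2 2).trans ?_
          nlinarith [sq_nonneg (‖x‖ - ‖Z z.2.toNNReal z.1‖)]
        nlinarith [mul_le_mul_of_nonneg_left h3 hc₀.le]
    _ = ENNReal.ofReal ((c₀ + κ + 2 * c₀ * ‖x‖ ^ 2) * (1 / ρ) + 2 * c₀ * M) := by
        rw [lintegral_add_left measurable_const, lintegral_const, hQ,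
          lintegral_const_mul' _ _ ENNReal.ofReal_ne_top, hMe,
          ← ENNReal.ofReal_mul (by positivity), ← ENNReal.ofReal_mul (by positivity),
          ← ENNReal.ofReal_add (by positivity) (by positivity)]
    _ ≤ _ := by
        refine ENNReal.ofReal_le_ofReal ?_
        have h1 : 0 ≤ (c₀ + κ) / ρ * ‖x‖ ^ 2 := by positivity
        have h2 : 0 ≤ 2 * c₀ / ρ := by positivity
        have h3 : 0 ≤ 2 * c₀ * M * ‖x‖ ^ 2 := by positivity
        have e : ((c₀ + κ + 2 * c₀) / ρ + 2 * c₀ * M) * (1 + ‖x‖ ^ 2)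
            = ((c₀ + κ + 2 * c₀ * ‖x‖ ^ 2) * (1 / ρ) + 2 * c₀ * M)
              + ((c₀ + κ) / ρ * ‖x‖ ^ 2 + 2 * c₀ / ρ + 2 * c₀ * M * ‖x‖ ^ 2) := by
          field_simp; ring
        rw [e]; linarith

/-- The discounted second moment of the stochastic convolution is finite, since
`∫ t e^{-ρt} dt < ∞`. -/
theorem IsStochasticConvolution.lintegral_discounted_sq_lt_top [IsProbabilityMeasure P]
    [TopologicalSpace.SeparableSpace (StateSpace μ)] {K : Type*} [NormedAddCommGroup K]
    [InnerProductSpace ℝ K] [CompleteSpace K] {W : ℝ≥0 → K → Ω → ℝ}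
    (hW : IsCylindricalWiener P 𝓕 W) (hSn : ∀ t x, ‖S t x‖ ≤ ‖x‖) {σ : K →L[ℝ] StateSpace μ}
    (hσ : IsHilbertSchmidt σ) (hZ : IsStochasticConvolution P W S σ Z) (hρ : 0 < ρ) :
    ∫⁻ z : Ω × ℝ, ‖Z z.2.toNNReal z.1‖ₑ ^ 2 ∂(P.prod (discountMeasure ρ)) < ∞ := by
  have := isFiniteMeasure_discountMeasure hρ
  obtain ⟨ι, b, hb⟩ := hσ
  have hT : ∑' i, ‖σ (b i)‖ₑ ^ 2 < ∞ := by
    simp only [enorm_sq_eq_ofReal]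
    rw [← ENNReal.ofReal_tsum_of_nonneg (fun i => by positivity) hb]
    exact ENNReal.ofReal_lt_top
  have hm : Measurable fun z : Ω × ℝ => ‖Z z.2.toNNReal z.1‖ₑ ^ 2 :=
    (hZ.measurable.comp_measurable
      (measurable_snd.real_toNNReal.prodMk measurable_fst)).enorm.pow_const 2
  rw [lintegral_prod_symm _ hm.aemeasurable]
  calc ∫⁻ t, ∫⁻ ω, ‖Z t.toNNReal ω‖ₑ ^ 2 ∂P ∂(discountMeasure ρ)
      ≤ ∫⁻ t, (2 * ∑' i, ‖σ (b i)‖ₑ ^ 2) * (t.toNNReal : ℝ≥0∞) ∂(discountMeasure ρ) := by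
        refine lintegral_mono fun t => (hZ.lintegral_sq_le hW hSn b t.toNNReal).trans ?_
        rw [mul_right_comm]
    _ = (2 * ∑' i, ‖σ (b i)‖ₑ ^ 2) * ∫⁻ t, (t.toNNReal : ℝ≥0∞) ∂(discountMeasure ρ) :=
        lintegral_const_mul' _ _ (by finiteness)
    _ < ∞ := by
        have := lintegral_toNNReal_discountMeasure_lt_top hρ
        finiteness

end ShiftedCost

section Infimum

/-- A partial infimum of a jointly convex family is convex. -/
theorem iInf_combination_le {H ι : Type*} [AddCommMonoid H] [Module ℝ≥0 H] {Φ : H → ι → ℝ≥0∞}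
    (hfin : ∀ x, (⨅ i, Φ x i) ≠ ∞) {a b : ℝ≥0} (hab : a + b = 1) {x y : H}
    (h : ∀ i j, ∃ k, Φ (a • x + b • y) k ≤ a * Φ x i + b * Φ y j) :
    ⨅ k, Φ (a • x + b • y) k ≤ a * (⨅ i, Φ x i) + b * ⨅ j, Φ y j := by
  refine ENNReal.le_of_forall_pos_le_add fun ε hε _ => ?_
  have hε' : (ε : ℝ≥0∞) ≠ 0 := by exact_mod_cast hε.ne'
  obtain ⟨i, hi⟩ := iInf_lt_iff.mp (ENNReal.lt_add_right (hfin x) hε')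
  obtain ⟨j, hj⟩ := iInf_lt_iff.mp (ENNReal.lt_add_right (hfin y) hε')
  obtain ⟨k, hk⟩ := h i j
  have hab' : (a : ℝ≥0∞) + b = 1 := by exact_mod_cast hab
  calc ⨅ k, Φ (a • x + b • y) k ≤ a * Φ x i + b * Φ y j := (iInf_le _ k).trans hk
    _ ≤ a * ((⨅ i, Φ x i) + ε) + b * ((⨅ j, Φ y j) + ε) := by gcongr
    _ = a * (⨅ i, Φ x i) + b * (⨅ j, Φ y j) + (a + b) * ε := by ring
    _ = _ := by rw [hab', one_mul]

theorem iInf_coe_ennreal_sub_coe {ι : Type*} (Φ : ι → ℝ≥0∞) (c : ℝ) :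
    ⨅ i, ((Φ i : EReal) - (c : EReal)) = ((⨅ i, Φ i : ℝ≥0∞) : EReal) - (c : EReal) := by
  refine le_antisymm ?_ (le_iInf fun i => EReal.sub_le_sub
    (EReal.coe_ennreal_le_coe_ennreal_iff.mpr (iInf_le _ i)) le_rfl)
  rw [EReal.le_sub_iff_add_le (Or.inl (EReal.coe_ne_bot _)) (Or.inl (EReal.coe_ne_top _))]
  refine ((le_max_right 0 _).trans EReal.coe_toENNReal_eq_max.ge).trans
    (EReal.coe_ennreal_le_coe_ennreal_iff.mpr
    (le_iInf fun i => ?_))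
  rw [← EReal.toENNReal_coe (x := Φ i)]
  refine EReal.toENNReal_le_toENNReal ?_
  rw [← EReal.le_sub_iff_add_le (Or.inl (EReal.coe_ne_bot _)) (Or.inl (EReal.coe_ne_top _))]
  exact iInf_le _ i

end Infimum

end SingularControl

open SingularControl in
theorem proposition3p1
    {D : Type*} [MeasurableSpace D] [StandardBorelSpace D] (μ : Measure D) [IsFiniteMeasure μ]
    {K : Type*} [NormedAddCommGroup K] [InnerProductSpace ℝ K] [CompleteSpace K]
    {Ω : Type*} [mΩ : MeasurableSpace Ω] (P : Measure Ω) [IsProbabilityMeasure P]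
    (𝓕 : Filtration ℝ≥0 mΩ) (h𝓕 : UsualConditions P 𝓕)
    -- the operator and its semigroup
    (A : StateSpace μ →ₗ.[ℝ] StateSpace μ) (hAdense : Dense (A.domain : Set (StateSpace μ)))
    (hAclosed : A.IsClosed) (hAself : IsSelfAdjoint A)
    (δ : ℝ) (hδ : 0 < δ) (hAdiss : IsDissipativeWith A δ)
    (S : ℝ≥0 → StateSpace μ →L[ℝ] StateSpace μ) (hS : IsC0Semigroup S) (hAS : IsGenerator A S)
    (hSpos : ∀ t, IsPositivityPreserving (S t))
    -- the noise
    (σ : K →L[ℝ] StateSpace μ) (hσ : IsHilbertSchmidt σ)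
    (W : ℝ≥0 → K → Ω → ℝ) (hW : IsCylindricalWiener P 𝓕 W)
    (Z : ℝ≥0 → Ω → StateSpace μ) (hZ : IsStochasticConvolution P W S σ Z)
    -- the control directions, the cost of control and the discount rate
    (Δ : PointedCone ℝ (StateSpace μ)) (hΔ : ∀ x ∈ Δ, 0 ≤ x)
    (q : StateSpace μ) (q₀ : ℝ) (hq₀ : 0 < q₀) (hq : ∀ᵐ ξ ∂μ, q₀ ≤ q ξ)
    (ρ : ℝ) (hρ : 0 < ρ)
    -- the running cost
    (G : StateSpace μ → ℝ) (hGconv : ConvexOn ℝ univ G)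
    (c₀ κ₁ κ₂ : ℝ) (hc₀ : 0 < c₀) (hκ₁ : 0 < κ₁) (hκ₂ : 0 < κ₂)
    (hGlower : ∀ x, κ₁ * ‖x‖ ^ 2 - κ₂ ≤ G x) (hGupper : ∀ x, G x ≤ c₀ * (1 + ‖x‖ ^ 2))
    (c₁ : ℝ) (hc₁ : 0 < c₁) (hGsemi : IsSemiconcave G c₁) :
    ∃ V : StateSpace μ → ℝ,
      (∀ x, valueFunction P 𝓕 Δ q ρ S Z G x = (V x : EReal)) ∧
      ConvexOn ℝ univ V ∧
      (∃ C₀ : ℝ, 0 < C₀ ∧ ∀ x, -κ₂ / ρ ≤ V x ∧ V x ≤ C₀ * (1 + ‖x‖ ^ 2)) ∧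
      LocallyLipschitz V ∧
      (∃ C₁ : ℝ, 0 < C₁ ∧ IsSemiconcave V C₁) ∧
      IsC1Lip V := by
  have : Fact ((2 : ℝ≥0∞) ≠ ∞) := ⟨by simp⟩
  have hSn := hAdiss.norm_semigroup_apply_le hδ.le hAdense hAS hS
  have hSc := hS.continuous_uncurry hSn
  have hGcont := continuous_of_convexOn_of_le_quadratic hGconv hc₀.le hGupper
  have hGκ : ∀ x, -κ₂ ≤ G x := fun x => by
    have := hGlower x
    have : 0 ≤ κ₁ * ‖x‖ ^ 2 := by positivity
    linarith
  obtain ⟨C, hC, hCle⟩ := exists_shiftedCost_zero_le (P := P) (𝓕 := 𝓕) (Δ := Δ) (q := q) hρ hSc hSn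
    hZ.measurable hGcont hc₀ hGupper hκ₂.le (hZ.lintegral_discounted_sq_lt_top hW hSn hσ hρ)
  set φ : StateSpace μ → ℝ≥0∞ := fun x => ⨅ I : AdmissibleControl P 𝓕 Δ q,
    shiftedCost ρ S Z G κ₂ x I with hφ
  have hφle : ∀ x, φ x ≤ ENNReal.ofReal (C * (1 + ‖x‖ ^ 2)) := fun x =>
    (iInf_le _ AdmissibleControl.zero).trans (hCle x)
  have hφfin : ∀ x, φ x ≠ ∞ := fun x => ne_top_of_le_ne_top ENNReal.ofReal_ne_top (hφle x)
  have hconv : ∀ (a b : ℝ≥0), a + b = 1 → ∀ x y, φ (a • x + b • y) ≤ a * φ x + b * φ y := by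
    intro a b hab x y
    exact iInf_combination_le hφfin hab fun I J => exists_shiftedCost_combination_le hρ hSc hSn
      hZ.measurable hGcont hGconv hGκ hq₀ hq I J hab x y
  have hsemi : ∀ (a b : ℝ≥0), a + b = 1 → ∀ x y, a * φ x + b * φ y
      ≤ φ (a • x + b • y) + ENNReal.ofReal (c₁ / ρ / 2 * a * b * ‖x - y‖ ^ 2) := by
    intro a b hab x y
    simp only [hφ]
    rw [ENNReal.iInf_add]
    refine le_iInf fun I => le_trans ?_ (shiftedCost_semiconcave hρ hSc hSn hZ.measurable hGcont
      hc₁.le hGsemi hGκ I hab x y)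
    gcongr <;> exact iInf_le _ I
  set V : StateSpace μ → ℝ := fun x => (φ x).toReal - κ₂ / ρ with hV
  have hVconv : ConvexOn ℝ univ V := by
    refine ⟨convex_univ, fun x _ y _ a b ha hb hab => ?_⟩
    lift a to ℝ≥0 using ha
    lift b to ℝ≥0 using hb
    have h := ENNReal.toReal_mono (by finiteness [hφfin x, hφfin y])
      (hconv a b (by exact_mod_cast hab) x y)
    rw [ENNReal.toReal_add (by finiteness [hφfin x]) (by finiteness [hφfin y]), ENNReal.toReal_mul,
      ENNReal.toReal_mul, ENNReal.coe_toReal, ENNReal.coe_toReal] at h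
    simp only [hV, smul_eq_mul]
    simp only [NNReal.smul_def] at h
    have e : κ₂ / ρ = a * (κ₂ / ρ) + b * (κ₂ / ρ) := by rw [← add_mul, hab, one_mul]
    linarith
  have hVsemi : IsSemiconcave V (c₁ / ρ) := by
    intro x y l hl
    obtain ⟨a, rfl⟩ : ∃ a : ℝ≥0, (a : ℝ) = l := ⟨⟨l, hl.1⟩, rfl⟩
    obtain ⟨b, hb⟩ : ∃ b : ℝ≥0, (b : ℝ) = 1 - a := ⟨⟨1 - a, by linarith [hl.2]⟩, rfl⟩
    have hab : a + b = 1 := by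
      have : (a : ℝ) + b = 1 := by linarith
      exact_mod_cast this
    have h := ENNReal.toReal_mono (by finiteness [hφfin (a • x + b • y)]) (hsemi a b hab x y)
    rw [ENNReal.toReal_add (by finiteness [hφfin x]) (by finiteness [hφfin y]), ENNReal.toReal_mul,
      ENNReal.toReal_mul, ENNReal.coe_toReal, ENNReal.coe_toReal,
      ENNReal.toReal_add (hφfin _) (by finiteness), ENNReal.toReal_ofReal (by positivity)] at h
    simp only [NNReal.smul_def, hb] at h
    simp only [hV]
    have e : (κ₂ / ρ : ℝ) = a * (κ₂ / ρ) + (1 - a) * (κ₂ / ρ) := by ring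
    linarith
  have hVup : ∀ x, V x ≤ C * (1 + ‖x‖ ^ 2) := fun x => by
    have h1 := ENNReal.toReal_mono ENNReal.ofReal_ne_top (hφle x)
    rw [ENNReal.toReal_ofReal (by positivity)] at h1
    have h2 : 0 ≤ κ₂ / ρ := by positivity
    simp only [hV]
    linarith
  have hVcont := continuous_of_convexOn_of_le_quadratic hVconv hC.le hVup
  have hC1 : IsC1Lip V :=
    isC1Lip_of_convexOn_of_isSemiconcave hVconv hVcont (by positivity) hVsemi
  refine ⟨V, fun x => ?_, hVconv, ⟨C, hC, fun x => ⟨?_, hVup x⟩⟩, hC1.1.locallyLipschitz,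
    ⟨c₁ / ρ, by positivity, hVsemi⟩, hC1⟩
  · have hcost := fun I : AdmissibleControl P 𝓕 Δ q =>
      cost_eq_shiftedCost_sub hρ hSc hZ.measurable hGcont hGκ hκ₂.le x I
    simp only [valueFunction, hcost]
    rw [iInf_coe_ennreal_sub_coe, hV, EReal.coe_sub, EReal.coe_ennreal_toReal (hφfin x)]
  · have : 0 ≤ (φ x).toReal := ENNReal.toReal_nonneg
    simp only [hV, neg_div]
    linarith
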